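/- **Theorem 6.3** (nilpotent CR symbols are realized by homogeneous hypersurfaces). Conventions. Let $M\subset\mathbb C^{n+1}$ be a smooth real hypersurface. Let $H\subset\mathbb C\otimes TM$ be its bundle of $(1,0)$-vectors. Let $K_p\subset H_p$ be the Levi kernel, that is, the set of $v\in H_p$ such that $[V,\overline W]_p\in H_p\oplus\overline{H_p}$ for all sections $V,W$ of $H$ with $V_p=v$. Let $\ell_p$ be the Hermitian form on $H_p/K_p$, with values in $\mathbb C T_pM/(H_p\oplus\overline{H_p})$, defined by $[X,\overline Y]_p\equiv 2i\,\ell_p(X_p,Y_p)$ modulo $H_p\oplus\overline{H_p}$. For $v\in K_p$ let $\mathrm{ad}_v$ be the $\ell_p$-self-adjoint antilinear operator on $H_p/K_p$ given by $\mathrm{ad}_v(X_p)\equiv[V,\overline X]_p$ modulo $\overline{H_p}\oplus K_p$, where $V$ is a section of $K$ with $V_p=v$. The hypersurface $M$ is (uniformly) $2$-nondegenerate with rank $1$ Levi kernel if $\dim_{\mathbb C}K_p=1$ and $v\mapsto\mathrm{ad}_v$ is injective on $K_p$ for all $p\in M$. It is homogeneous if its CR automorphisms act transitively on it. Let $m=n-1\ge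 0$. A pair $(H_\ell,A)$ of complex $m\times m$ matrices encodes a CR symbol (with one-dimensional Levi kernel) if $H_\ell$ is the matrix of a nondegenerate Hermitian form $\ell$ on $\mathbb C^m$, $\ell(x,y)=x^TH_\ell\,\overline y$, and $A\neq0$ is the matrix of an $\ell$-self-adjoint antilinear operator $a:x\mapsto A\overline x$, that is, $\ell(a x,y)=\ell(a y,x)$ for all $x,y\in\mathbb C^m$. The CR symbol of $M$ at $p$ is the one encoded by $(H_\ell,A)$ if, for some basis of $H_p/K_p$, some basis vector $v$ of $K_p$ and some real basis vector of $\mathbb C T_pM/(H_p\oplus\overline{H_p})$, the form $\ell_p$ has matrix $H_\ell$ and the operator $\mathrm{ad}_v$ has matrix $A$. Statement. Let $(H_\ell,A)$ encode a CR symbol, and suppose that the antilinear operator $x\mapsto A\overline x$ is nilpotent (equivalently, that the matrix $A\overline A$ is nilpotent). Then there is a connected homogeneous real hypersurface $M\subset\mathbb C^{m+2}$ that is $2$-nondegenerate with rank $1$ Levi kernel and whose CR symbol at every point is the one encoded by $(H_\ell,A)$. -/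

import Mathlib

open scoped ContDiff Matrix

/-! Real hypersurfaces of `ℂ^N`, their CR structure, Levi kernel, and CR symbols.

A complex tangent vector of `ℂ^N`, i.e. an element of `ℂ ⊗ T ℂ^N`, is written as a pair `(a, b)`,
which stands for `∑ a_j ∂/∂z_j + ∑ b_j ∂/∂(conj z_j)`.  A real tangent vector `v` is the pair
`(v, star v)`, and complex conjugation is `(a, b) ↦ (star b, star a)`. -/

namespace CRGeom

/-- The space `ℂ^N`. -/
abbrev Cspace (N : ℕ) : Type := Fin N → ℂ

/-- Complex tangent vectors `∑ a_j ∂/∂z_j + ∑ b_j ∂/∂(conj z_j)` of `ℂ^N`. -/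
abbrev CVec (N : ℕ) : Type := Cspace N × Cspace N

/-- The complex-linear extension to `ℂ ⊗ T ℂ^N` of a real-linear map `L`.
The complex vector `(a, b)` is `u + i w` with real vectors `u = (a + star b) / 2` and
`w = (a - star b) / (2 i)`, and is sent to `L u + i L w`. -/
noncomputable def complexify {N : ℕ} {W : Type*} [AddCommGroup W] [Module ℂ W] [Module ℝ W]
    [IsScalarTower ℝ ℂ W] (L : Cspace N →ₗ[ℝ] W) : CVec N →ₗ[ℂ] W where
  toFun Z := L ((1 / 2 : ℂ) • (Z.1 + star Z.2)) +
    Complex.I • L ((1 / (2 * Complex.I) : ℂ) • (Z.1 - star Z.2))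
  map_add' Z Y := by
    have h1 : (1 / 2 : ℂ) • ((Z + Y).1 + star (Z + Y).2) =
        (1 / 2 : ℂ) • (Z.1 + star Z.2) + (1 / 2 : ℂ) • (Y.1 + star Y.2) := by
      simp only [Prod.fst_add, Prod.snd_add, star_add]; module
    have h2 : (1 / (2 * Complex.I) : ℂ) • ((Z + Y).1 - star (Z + Y).2) =
        (1 / (2 * Complex.I) : ℂ) • (Z.1 - star Z.2) +
          (1 / (2 * Complex.I) : ℂ) • (Y.1 - star Y.2) := by
      simp only [Prod.fst_add, Prod.snd_add, star_add]; module
    rw [h1, h2, LinearMap.map_add, LinearMap.map_add, smul_add Complex.I]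
    rw [add_add_add_comm]
  map_smul' c Z := by
    have hI : Complex.I * Complex.I = -1 := Complex.I_mul_I
    have hinv : (1 / (2 * Complex.I) : ℂ) = -Complex.I / 2 := by
      rw [div_eq_iff (by simp)]; linear_combination hI
    obtain ⟨s, t, hc, hcs⟩ : ∃ s t : ℝ, c = s + t * Complex.I ∧ star c = s - t * Complex.I :=
      ⟨c.re, c.im, (Complex.re_add_im c).symm, by apply Complex.ext <;> simp⟩
    have h1 : (1 / 2 : ℂ) • ((c • Z).1 + star (c • Z).2) =
        s • ((1 / 2 : ℂ) • (Z.1 + star Z.2)) -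
          t • ((1 / (2 * Complex.I) : ℂ) • (Z.1 - star Z.2)) := by
      ext j
      simp only [hinv, Prod.smul_fst, Prod.smul_snd, star_smul, Pi.smul_apply,
        Pi.add_apply, Pi.sub_apply, smul_eq_mul, Complex.real_smul, hcs]
      rw [hc]
      ring
    have h2 : (1 / (2 * Complex.I) : ℂ) • ((c • Z).1 - star (c • Z).2) =
        s • ((1 / (2 * Complex.I) : ℂ) • (Z.1 - star Z.2)) +
          t • ((1 / 2 : ℂ) • (Z.1 + star Z.2)) := by
      ext j
      simp only [hinv, Prod.smul_fst, Prod.smul_snd, star_smul, Pi.smul_apply,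
        Pi.add_apply, Pi.sub_apply, smul_eq_mul, Complex.real_smul, hcs]
      rw [hc]
      linear_combination (-(t : ℂ) * (Z.1 j + (star Z.2) j) / 2) * hI
    have hr : ∀ (r : ℝ) (y : W), r • y = (r : ℂ) • y := fun r y => by
      rw [← algebraMap_smul ℂ r y]; rfl
    rw [h1, h2]
    generalize (1 / 2 : ℂ) • (Z.1 + star Z.2) = u
    generalize (1 / (2 * Complex.I) : ℂ) • (Z.1 - star Z.2) = w
    rw [LinearMap.map_sub, LinearMap.map_add, LinearMap.map_smul, LinearMap.map_smul,
      LinearMap.map_smul, LinearMap.map_smul, RingHom.id_apply, hr, hr, hr, hr, hc]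
    match_scalars
    · ring
    · linear_combination (-(t : ℂ)) * hI

/-- The derivative `Z F` at `p` of a vector-valued function `F` along the complex tangent
vector `Z`. -/
noncomputable def cderiv {N : ℕ} {W : Type*} [NormedAddCommGroup W] [NormedSpace ℂ W]
    [NormedSpace ℝ W] [IsScalarTower ℝ ℂ W] (F : Cspace N → W) (p : Cspace N) :
    CVec N →ₗ[ℂ] W :=
  complexify (fderiv ℝ F p : Cspace N →ₗ[ℝ] W)

/-- The Lie bracket `[X, Y] = X Y - Y X` of complex vector fields on `ℂ^N`. -/
noncomputable def bracket {N : ℕ} (X Y : Cspace N → CVec N) (p : Cspace N) : CVec N :=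
  cderiv Y p (X p) - cderiv X p (Y p)

/-- The complex vector field `∑ X_j ∂/∂z_j`. -/
def holField {N : ℕ} (X : Cspace N → Cspace N) (x : Cspace N) : CVec N := (X x, 0)

/-- The complex conjugate `∑ conj(X_j) ∂/∂(conj z_j)` of the vector field `∑ X_j ∂/∂z_j`. -/
def conjField {N : ℕ} (X : Cspace N → Cspace N) (x : Cspace N) : CVec N := (0, star (X x))

/-- `M` is a smooth embedded real hypersurface of `ℂ^N`: near each of its points it is the zero
set of a smooth real function with nonvanishing differential. -/
def IsRealHypersurface {N : ℕ} (M : Set (Cspace N)) : Prop :=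
  ∀ p ∈ M, ∃ (U : Set (Cspace N)) (ρ : Cspace N → ℝ), IsOpen U ∧ p ∈ U ∧ ContDiffOn ℝ ∞ ρ U ∧
    (∀ x ∈ U, x ∈ M ↔ ρ x = 0) ∧ ∀ x ∈ U, fderiv ℝ ρ x ≠ 0

/-- The complexified tangent space `ℂ ⊗ T_p M`: the complex tangent vectors at `p` that annihilate
every smooth real function, defined near `p`, which vanishes on `M`. -/
noncomputable def ctangent {N : ℕ} (M : Set (Cspace N)) (p : Cspace N) :
    Submodule ℂ (CVec N) where
  carrier := {Z | ∀ (U : Set (Cspace N)) (f : Cspace N → ℝ), IsOpen U → p ∈ U →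
    ContDiffOn ℝ ∞ f U → (∀ x ∈ M ∩ U, f x = 0) → cderiv (fun x => (f x : ℂ)) p Z = 0}
  zero_mem' := fun U f _ _ _ _ => map_zero _
  add_mem' := fun {Z Y} hZ hY U f hU hp hf h0 => by
    rw [map_add, hZ U f hU hp hf h0, hY U f hU hp hf h0, add_zero]
  smul_mem' := fun c Z hZ U f hU hp hf h0 => by
    rw [map_smul, hZ U f hU hp hf h0, smul_zero]

/-- The fibre `H_p` of the tangential Cauchy-Riemann bundle: the vectors `∑ a_j ∂/∂z_j` in
`ℂ ⊗ T_p M`, recorded by their coefficients `a`. -/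
noncomputable def crSpace {N : ℕ} (M : Set (Cspace N)) (p : Cspace N) :
    Submodule ℂ (Cspace N) :=
  (ctangent M p).comap (LinearMap.inl ℂ (Cspace N) (Cspace N))

/-- The fibre `conj(H_p)`: the vectors `∑ b_j ∂/∂(conj z_j)` in `ℂ ⊗ T_p M`, recorded by their
coefficients `b`. -/
noncomputable def crSpaceBar {N : ℕ} (M : Set (Cspace N)) (p : Cspace N) :
    Submodule ℂ (Cspace N) :=
  (ctangent M p).comap (LinearMap.inr ℂ (Cspace N) (Cspace N))

/-- `X` is, near `p`, a smooth section over `M` of the family `F` of spaces of `(1,0)`-vectors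
(given through a smooth extension of `X` to a neighbourhood of `p` in `ℂ^N`). -/
def IsSectionNear {N : ℕ} (M : Set (Cspace N)) (F : Cspace N → Submodule ℂ (Cspace N))
    (p : Cspace N) (X : Cspace N → Cspace N) : Prop :=
  ∃ U : Set (Cspace N), IsOpen U ∧ p ∈ U ∧ ContDiffOn ℝ ∞ X U ∧ ∀ x ∈ M ∩ U, X x ∈ F x

/-- The Levi kernel `K_p`: the `v ∈ H_p` such that `[V, conj W]_p ∈ H_p ⊕ conj(H_p)` for all
sections `V`, `W` of `H` near `p` with `V_p = v`.  (On a hypersurface these `v` already form a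
subspace, because the Levi form is a tensor.) -/
noncomputable def leviKernel {N : ℕ} (M : Set (Cspace N)) (p : Cspace N) :
    Submodule ℂ (Cspace N) :=
  Submodule.span ℂ {v | v ∈ crSpace M p ∧ ∀ V W : Cspace N → Cspace N,
    IsSectionNear M (crSpace M) p V → IsSectionNear M (crSpace M) p W → V p = v →
      bracket (holField V) (conjField W) p ∈ (crSpace M p).prod (crSpaceBar M p)}

/-- Uniform 2-nondegeneracy with Levi kernel of rank `r ≥ 1`: the Levi kernel has constant rank
`r`, and at every point `p` the map `v ↦ ad_v` is injective on `K_p`, where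
`ad_v(X_p) = [V, conj X]_p` modulo `conj(H_p) ⊕ K_p` for sections `V` of `K` and `X` of `H` with
`V_p = v`. -/
def IsTwoNondegenerate {N : ℕ} (M : Set (Cspace N)) (r : ℕ) : Prop :=
  1 ≤ r ∧ ∀ p ∈ M, Module.finrank ℂ (leviKernel M p) = r ∧
    ∀ v ∈ leviKernel M p,
      (∀ V X : Cspace N → Cspace N, IsSectionNear M (leviKernel M) p V →
        IsSectionNear M (crSpace M) p X → V p = v →
        bracket (holField V) (conjField X) p ∈ (leviKernel M p).prod (crSpaceBar M p)) → v = 0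

/-- `φ` restricts to a smooth CR map from `M` to `M`: its complexified differential maps `H_p`
into `H_{φ(p)}` for every `p ∈ M`. -/
def IsCRMap {N : ℕ} (M : Set (Cspace N)) (φ : Cspace N → Cspace N) : Prop :=
  (∃ U : Set (Cspace N), IsOpen U ∧ M ⊆ U ∧ ContDiffOn ℝ ∞ φ U) ∧ Set.MapsTo φ M M ∧
    ∀ p ∈ M, ∀ a ∈ crSpace M p,
      cderiv φ p (a, 0) ∈ crSpace M (φ p) ∧ cderiv (fun x => star (φ x)) p (a, 0) = 0

/-- `M` is homogeneous: the group of its CR automorphisms acts transitively on it. -/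
def IsHomogeneous {N : ℕ} (M : Set (Cspace N)) : Prop :=
  ∀ p ∈ M, ∀ q ∈ M, ∃ φ ψ : Cspace N → Cspace N, IsCRMap M φ ∧ IsCRMap M ψ ∧
    (∀ x ∈ M, ψ (φ x) = x ∧ φ (ψ x) = x) ∧ φ p = q

/-- The sesquilinear form `ℓ(x, y) = ∑ x_j H_{jk} conj(y_k)` with matrix `H`. -/
def sesqForm {m : ℕ} (H : Matrix (Fin m) (Fin m) ℂ) (x y : Fin m → ℂ) : ℂ :=
  x ⬝ᵥ (H *ᵥ star y)

/-- The antilinear operator `x ↦ A conj(x)` with matrix `A`. -/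
def antilinearOp {m : ℕ} (A : Matrix (Fin m) (Fin m) ℂ) (x : Fin m → ℂ) : Fin m → ℂ :=
  A *ᵥ star x

/-- `(H, A)` encodes a CR symbol with one-dimensional Levi kernel: `H` is the matrix of a
nondegenerate Hermitian form `ℓ`, and `A` is the matrix of a nonzero `ℓ`-self-adjoint antilinear
operator. -/
structure EncodesCRSymbol {m : ℕ} (H A : Matrix (Fin m) (Fin m) ℂ) : Prop where
  hermitian : H.IsHermitian
  nondegenerate : IsUnit H.det
  selfAdjoint : ∀ x y : Fin m → ℂ,
    sesqForm H (antilinearOp A x) y = sesqForm H (antilinearOp A y) x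
  ne_zero : A ≠ 0

/-- The CR symbol of `M` at `p` is the one encoded by `(H, A)`: with respect to a basis
`X_1(p), …, X_m(p)` of `H_p / K_p`, a vector `V(p)` spanning `K_p`, and a real vector `τ` spanning
`ℂ ⊗ T_p M` modulo `H_p ⊕ conj(H_p)`, the Levi form `ℓ`, which is determined by
`[X, conj Y] = 2 i ℓ(X, Y)` modulo `H_p ⊕ conj(H_p)`, has matrix `H`, and the antilinear operator
`ad_V : X ↦ [V, conj X]` modulo `conj(H_p) ⊕ K_p` of `H_p / K_p` has matrix `A`.
Both maps depend only on the values at `p` of the sections of `H` and `K` used to compute them. -/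
def HasCRSymbol {N m : ℕ} (M : Set (Cspace N)) (p : Cspace N)
    (H A : Matrix (Fin m) (Fin m) ℂ) : Prop :=
  ∃ (X : Fin m → Cspace N → Cspace N) (V : Cspace N → Cspace N) (τ : Cspace N),
    (∀ j, IsSectionNear M (crSpace M) p (X j)) ∧ IsSectionNear M (leviKernel M) p V ∧
    LinearIndependent ℂ (Fin.cons (V p) (fun j => X j p) : Fin (m + 1) → Cspace N) ∧
    Submodule.span ℂ (Set.range (Fin.cons (V p) (fun j => X j p) : Fin (m + 1) → Cspace N)) =
      crSpace M p ∧
    Submodule.span ℂ {V p} = leviKernel M p ∧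
    (τ, star τ) ∈ ctangent M p ∧ (τ, star τ) ∉ (crSpace M p).prod (crSpaceBar M p) ∧
    (∀ j k, bracket (holField (X j)) (conjField (X k)) p -
      (2 * Complex.I * H j k) • ((τ, star τ) : CVec N) ∈ (crSpace M p).prod (crSpaceBar M p)) ∧
    (∀ k, bracket (holField V) (conjField (X k)) p - ((∑ j, A j k • X j p, 0) : CVec N) ∈
      (leviKernel M p).prod (crSpaceBar M p))

end CRGeom

open scoped ContDiff Matrix

/-! The hypersurface is an explicit one. Let `s` be a nilpotent antilinear operator on ℂ^m,
self-adjoint for a nondegenerate Hermitian form `ell`, and let `M` be given in coordinates (ζ, w, z)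
by Re w = Re ell(E(η) z, z), η = Im ζ > 0, with E(η) = sec(2ηs) + tan(2ηs). Nilpotency makes every
series finite. Even powers of `s` are complex-linear and odd powers antilinear, so sec is the linear
and tan the antilinear part of E.

The Levi form: from E' = 2 s sec E and E'' = 4 s² sec E² the mixed terms complete to a square, and
up to a constant the Levi form is ell(z', sec(2ηs) z''), where z', z'' are taken relative to one
distinguished direction (`cderiv_form`). That direction spans the Levi kernel (`leviKernel_eq`), and
up to a scalar its ad-operator is s sec(2ηs).

Homogeneity: `M` is invariant under translations of Re ζ and Im w. A trace argument gives an
operator h with [h, s] = s, which averaging makes complex-linear and skew for `ell`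
(`exists_gradedForm`); then ζ ↦ e^t ζ, z ↦ exp(th) z preserves `M`. Finally there are holomorphic
curves f with E(Im ζ) f(ζ) = f(conj ζ) (`E_leaf`), and translating z by f(ζ), with a holomorphic
correction of w, preserves `M`. These maps act transitively.

The prescribed symbol: at η = 1/2 the model has form ell(·, sec(s) ·) and operator s sec(s). So one
solves s = a cos(s) by an odd polynomial in the given nilpotent operator a (`exists_sec_root`) and
takes ell = ℓ(cos(s) ·, ·). -/

namespace CRGeom

/-! ### Derivatives along (1,0) and (0,1) vectors, and brackets. -/

section Complexify

variable {N : ℕ}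

theorem complexify_apply {W : Type*} [AddCommGroup W] [Module ℂ W] [Module ℝ W]
    [IsScalarTower ℝ ℂ W] (L : Cspace N →ₗ[ℝ] W) (Z : CVec N) :
    complexify L Z = L ((1 / 2 : ℂ) • (Z.1 + star Z.2)) +
      Complex.I • L ((1 / (2 * Complex.I) : ℂ) • (Z.1 - star Z.2)) := rfl

theorem half_smul_eq (v : Cspace N) : (1 / 2 : ℂ) • v = (1 / 2 : ℝ) • v := by
  ext j; simp [Complex.real_smul]

theorem inv_two_I_smul_eq (v : Cspace N) :
    (1 / (2 * Complex.I) : ℂ) • v = (-(1 / 2) : ℝ) • (Complex.I • v) := by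
  ext j
  simp only [Pi.smul_apply, smul_eq_mul, Complex.real_smul]
  push_cast
  have : (1 / (2 * Complex.I) : ℂ) = -(1 / 2) * Complex.I := by
    rw [div_eq_iff (by simp)]; linear_combination Complex.I_mul_I
  rw [this]; ring

theorem real_smul_eq_complex {W : Type*} [AddCommGroup W] [Module ℂ W] [Module ℝ W]
    [IsScalarTower ℝ ℂ W] (r : ℝ) (y : W) : r • y = (r : ℂ) • y := by
  rw [← algebraMap_smul ℂ r y]; rfl

theorem complexify_inl {W : Type*} [AddCommGroup W] [Module ℂ W] [Module ℝ W]
    [IsScalarTower ℝ ℂ W] (L : Cspace N →ₗ[ℝ] W) (a : Cspace N) :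
    complexify L (a, 0) = (1 / 2 : ℂ) • (L a - Complex.I • L (Complex.I • a)) := by
  rw [complexify_apply]
  simp only [star_zero, add_zero, sub_zero]
  rw [half_smul_eq, inv_two_I_smul_eq, map_smul, map_smul, real_smul_eq_complex,
    real_smul_eq_complex]
  push_cast
  module

theorem complexify_inr {W : Type*} [AddCommGroup W] [Module ℂ W] [Module ℝ W]
    [IsScalarTower ℝ ℂ W] (L : Cspace N →ₗ[ℝ] W) (b : Cspace N) :
    complexify L (0, b) =
      (1 / 2 : ℂ) • (L (star b) + Complex.I • L (Complex.I • star b)) := by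
  rw [complexify_apply]
  simp only [zero_add, zero_sub]
  rw [half_smul_eq, inv_two_I_smul_eq, map_smul, map_smul, real_smul_eq_complex,
    real_smul_eq_complex, smul_neg, map_neg]
  push_cast
  module

theorem star_real_smul_Cspace (r : ℝ) (v : Cspace N) : star (r • v) = r • star v := by
  ext j; simp [Complex.real_smul]

variable {W : Type*} [NormedAddCommGroup W] [NormedSpace ℂ W] [NormedSpace ℝ W]
  [IsScalarTower ℝ ℂ W]

theorem cderiv_inl (F : Cspace N → W) (p a : Cspace N) :
    cderiv F p (a, 0) =
      (1 / 2 : ℂ) • (fderiv ℝ F p a - Complex.I • fderiv ℝ F p (Complex.I • a)) :=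
  complexify_inl _ a

theorem cderiv_inr (F : Cspace N → W) (p b : Cspace N) :
    cderiv F p (0, b) = (1 / 2 : ℂ) •
      (fderiv ℝ F p (star b) + Complex.I • fderiv ℝ F p (Complex.I • star b)) :=
  complexify_inr _ b

theorem cderiv_ofReal {f : Cspace N → ℝ} {p : Cspace N} (hf : DifferentiableAt ℝ f p)
    (Z : CVec N) : cderiv (fun x => (f x : ℂ)) p Z =
      fderiv ℝ f p ((1 / 2 : ℂ) • (Z.1 + star Z.2)) +
      Complex.I * fderiv ℝ f p ((1 / (2 * Complex.I) : ℂ) • (Z.1 - star Z.2)) := by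
  have h : HasFDerivAt (fun x => (f x : ℂ)) (Complex.ofRealCLM.comp (fderiv ℝ f p)) p :=
    Complex.ofRealCLM.hasFDerivAt.comp p hf.hasFDerivAt
  unfold cderiv
  rw [complexify_apply, h.fderiv]
  rfl

/-- Tangency is tested on real functions only; this extends the test to complex-valued ones. -/
theorem cderiv_real_add_I_mul {g : Cspace N → ℂ} {p : Cspace N} (hg : DifferentiableAt ℝ g p)
    (Z : CVec N) : cderiv g p Z = cderiv (fun x => ((g x).re : ℂ)) p Z +
      Complex.I * cderiv (fun x => ((g x).im : ℂ)) p Z := by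
  have h1 : HasFDerivAt (fun x => (g x).re) (Complex.reCLM.comp (fderiv ℝ g p)) p :=
    Complex.reCLM.hasFDerivAt.comp p hg.hasFDerivAt
  have h2 : HasFDerivAt (fun x => (g x).im) (Complex.imCLM.comp (fderiv ℝ g p)) p :=
    Complex.imCLM.hasFDerivAt.comp p hg.hasFDerivAt
  rw [cderiv_ofReal h1.differentiableAt, cderiv_ofReal h2.differentiableAt, h1.fderiv, h2.fderiv]
  unfold cderiv
  rw [complexify_apply]
  simp only [ContinuousLinearMap.coe_comp, Function.comp_apply, Complex.reCLM_apply,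
    Complex.imCLM_apply, ContinuousLinearMap.coe_coe, smul_eq_mul]
  generalize fderiv ℝ g p ((1 / 2 : ℂ) • (Z.1 + star Z.2)) = u
  generalize fderiv ℝ g p ((1 / (2 * Complex.I) : ℂ) • (Z.1 - star Z.2)) = w
  conv_lhs => rw [← Complex.re_add_im u, ← Complex.re_add_im w]
  ring

theorem cderiv_clm_apply {Θ : Cspace N → Cspace N →L[ℂ] ℂ} {X : Cspace N → Cspace N}
    {p : Cspace N} (hΘ : DifferentiableAt ℝ Θ p) (hX : DifferentiableAt ℝ X p) (Z : CVec N) :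
    cderiv (fun x => Θ x (X x)) p Z = cderiv Θ p Z (X p) + Θ p (cderiv X p Z) := by
  have h1 : HasFDerivAt (fun x => (Θ x).restrictScalars ℝ)
      ((ContinuousLinearMap.restrictScalarsL ℂ (Cspace N) ℂ ℝ ℝ).comp (fderiv ℝ Θ p)) p :=
    (ContinuousLinearMap.restrictScalarsL ℂ (Cspace N) ℂ ℝ ℝ).hasFDerivAt.comp p hΘ.hasFDerivAt
  have h2 := h1.clm_apply hX.hasFDerivAt
  have h3 : ∀ v, fderiv ℝ (fun x => Θ x (X x)) p v =
      Θ p (fderiv ℝ X p v) + fderiv ℝ Θ p v (X p) := by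
    intro v
    have : fderiv ℝ (fun x => Θ x (X x)) p = _ := h2.fderiv
    rw [this]; rfl
  unfold cderiv
  simp only [complexify_apply, ContinuousLinearMap.coe_coe, h3, map_add, map_smul,
    _root_.add_apply, _root_.smul_apply, smul_add]
  ring

theorem cderiv_holField {X : Cspace N → Cspace N} {p : Cspace N} (hX : DifferentiableAt ℝ X p)
    (Z : CVec N) : cderiv (holField X) p Z = (cderiv X p Z, 0) := by
  have h : HasFDerivAt (holField X) ((fderiv ℝ X p).prod 0) p :=
    hX.hasFDerivAt.prodMk (hasFDerivAt_const (0 : Cspace N) p)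
  unfold cderiv
  rw [h.fderiv]
  ext <;> simp [complexify_apply]

theorem hasFDerivAt_star {X : Cspace N → Cspace N} {p : Cspace N} {X' : Cspace N →L[ℝ] Cspace N}
    (hX : HasFDerivAt X X' p) : HasFDerivAt (fun x => star (X x))
      (((starL' ℝ : Cspace N ≃L[ℝ] Cspace N) : Cspace N →L[ℝ] Cspace N).comp X') p :=
  ((starL' ℝ : Cspace N ≃L[ℝ] Cspace N) : Cspace N →L[ℝ] Cspace N).hasFDerivAt.comp p hX

theorem cderiv_star {X : Cspace N → Cspace N} {p : Cspace N} (hX : DifferentiableAt ℝ X p)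
    (a : Cspace N) :
    cderiv (fun x => star (X x)) p (a, 0) = star (cderiv X p (0, star a)) := by
  have h := hasFDerivAt_star hX.hasFDerivAt
  rw [cderiv_inl, cderiv_inr, h.fderiv]
  ext j
  simp [sub_eq_add_neg, mul_add]

theorem cderiv_conjField {X : Cspace N → Cspace N} {p : Cspace N} (hX : DifferentiableAt ℝ X p)
    (a : Cspace N) : cderiv (conjField X) p (a, 0) = (0, star (cderiv X p (0, star a))) := by
  have h : HasFDerivAt (conjField X)
      ((0 : Cspace N →L[ℝ] Cspace N).prod (fderiv ℝ (fun x => star (X x)) p)) p :=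
    (hasFDerivAt_const (0 : Cspace N) p).prodMk
      (hasFDerivAt_star hX.hasFDerivAt).differentiableAt.hasFDerivAt
  rw [← cderiv_star hX]
  unfold cderiv
  rw [h.fderiv]
  ext <;> simp [complexify_apply]

theorem bracket_hol_conj {X Y : Cspace N → Cspace N} {p : Cspace N}
    (hX : DifferentiableAt ℝ X p) (hY : DifferentiableAt ℝ Y p) :
    bracket (holField X) (conjField Y) p =
      (-cderiv X p (0, star (Y p)), star (cderiv Y p (0, star (X p)))) := by
  unfold bracket
  rw [show holField X p = (X p, 0) from rfl, show conjField Y p = (0, star (Y p)) from rfl,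
    cderiv_conjField hY, cderiv_holField hX]
  ext <;> simp

end Complexify

/-! ### CR spaces and Levi form read off from a (1,0)-form Θ with dρ = Re Θ. -/

section Hypersurface

variable {N : ℕ} {M : Set (Cspace N)}

theorem cderiv_eq_zero_of_vanishing {p : Cspace N} {Z : CVec N} (hZ : Z ∈ ctangent M p)
    {U : Set (Cspace N)} (hU : IsOpen U) (hp : p ∈ U) {g : Cspace N → ℂ}
    (hg : ContDiffOn ℝ ∞ g U) (h0 : ∀ x ∈ M ∩ U, g x = 0) : cderiv g p Z = 0 := by
  have hd : DifferentiableAt ℝ g p :=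
    (hg.contDiffAt (hU.mem_nhds hp)).differentiableAt (by simp)
  rw [cderiv_real_add_I_mul hd,
    hZ U (fun x => (g x).re) hU hp (Complex.reCLM.contDiff.comp_contDiffOn hg)
      (fun x hx => by simp [h0 x hx]),
    hZ U (fun x => (g x).im) hU hp (Complex.imCLM.contDiff.comp_contDiffOn hg)
      (fun x hx => by simp [h0 x hx])]
  simp

theorem IsSectionNear.differentiableAt {F : Cspace N → Submodule ℂ (Cspace N)} {p : Cspace N}
    {X : Cspace N → Cspace N} (h : IsSectionNear M F p X) : DifferentiableAt ℝ X p := by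
  obtain ⟨U, hU, hp, hX, -⟩ := h
  exact (hX.contDiffAt (hU.mem_nhds hp)).differentiableAt (by simp)

theorem IsSectionNear.mem {F : Cspace N → Submodule ℂ (Cspace N)} {p : Cspace N}
    {X : Cspace N → Cspace N} (h : IsSectionNear M F p X) (hpM : p ∈ M) : X p ∈ F p := by
  obtain ⟨U, hU, hp, -, hX⟩ := h
  exact hX p ⟨hpM, hp⟩

theorem IsSectionNear.mono {F G : Cspace N → Submodule ℂ (Cspace N)} {p : Cspace N}
    {X : Cspace N → Cspace N} (h : IsSectionNear M F p X) (hFG : ∀ x ∈ M, F x ≤ G x) :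
    IsSectionNear M G p X := by
  obtain ⟨U, hU, hp, hX, hm⟩ := h
  exact ⟨U, hU, hp, hX, fun x hx => hFG x hx.1 (hm x hx)⟩

theorem IsSectionNear.const_smul {F : Cspace N → Submodule ℂ (Cspace N)} {p : Cspace N}
    {X : Cspace N → Cspace N} (h : IsSectionNear M F p X) (c : ℂ) :
    IsSectionNear M F p (fun x => c • X x) := by
  obtain ⟨U, hU, hp, hX, hm⟩ := h
  exact ⟨U, hU, hp, hX.const_smul c, fun x hx => (F x).smul_mem c (hm x hx)⟩

/-- A hypersurface given on the open set `Ω` by a defining function `ρ` with `dρ = Re Θ` for a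
smooth `(1,0)`-form `Θ`, such that `x ↦ x - ρ(x) e` is a retraction onto the hypersurface. -/
structure IsDefinedBy (M Ω : Set (Cspace N)) (ρ : Cspace N → ℝ)
    (Θ : Cspace N → Cspace N →L[ℂ] ℂ) (e : Cspace N) : Prop where
  isOpen : IsOpen Ω
  eq : M = {x | x ∈ Ω ∧ ρ x = 0}
  smooth : ContDiffOn ℝ ∞ ρ Ω
  smooth_form : ContDiffOn ℝ ∞ Θ Ω
  fderiv_eq : ∀ x ∈ Ω, ∀ v, fderiv ℝ ρ x v = (Θ x v).re
  form_normal : ∀ x ∈ Ω, (Θ x e).re = 1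
  retract : ∀ x ∈ Ω, x - ρ x • e ∈ M

namespace IsDefinedBy

variable {Ω : Set (Cspace N)} {ρ : Cspace N → ℝ} {Θ : Cspace N → Cspace N →L[ℂ] ℂ}
  {e : Cspace N}

theorem mem_domain (h : IsDefinedBy M Ω ρ Θ e) {p : Cspace N} (hp : p ∈ M) : p ∈ Ω := by
  rw [h.eq] at hp; exact hp.1

theorem apply_eq_zero (h : IsDefinedBy M Ω ρ Θ e) {p : Cspace N} (hp : p ∈ M) : ρ p = 0 := by
  rw [h.eq] at hp; exact hp.2

theorem isRealHypersurface (h : IsDefinedBy M Ω ρ Θ e) : IsRealHypersurface M := by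
  intro p hp
  refine ⟨Ω, ρ, h.isOpen, h.mem_domain hp, h.smooth, fun x hx => ?_, fun x hx h0 => ?_⟩
  · rw [h.eq]; exact ⟨fun hx => hx.2, fun h0 => ⟨hx, h0⟩⟩
  · have := h.fderiv_eq x hx e
    rw [h0, h.form_normal x hx] at this
    simp at this

theorem differentiableAt (h : IsDefinedBy M Ω ρ Θ e)
    {p : Cspace N} (hp : p ∈ M) : DifferentiableAt ℝ ρ p :=
  (h.smooth.contDiffAt (h.isOpen.mem_nhds (h.mem_domain hp))).differentiableAt (by simp)

theorem differentiableAt_form (h : IsDefinedBy M Ω ρ Θ e)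
    {p : Cspace N} (hp : p ∈ M) : DifferentiableAt ℝ Θ p :=
  (h.smooth_form.contDiffAt (h.isOpen.mem_nhds (h.mem_domain hp))).differentiableAt (by simp)

theorem cderiv_eq (h : IsDefinedBy M Ω ρ Θ e) {p : Cspace N} (hp : p ∈ M) (Z : CVec N) :
    cderiv (fun x => (ρ x : ℂ)) p Z = (1 / 2) * (Θ p Z.1 + star (Θ p (star Z.2))) := by
  rw [cderiv_ofReal (h.differentiableAt hp), h.fderiv_eq p (h.mem_domain hp),
    h.fderiv_eq p (h.mem_domain hp)]
  simp only [map_smul, map_add, map_sub, smul_eq_mul]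
  have : (1 / (2 * Complex.I) : ℂ) = -(1 / 2) * Complex.I := by
    rw [div_eq_iff (by simp)]; linear_combination Complex.I_mul_I
  rw [this]
  apply Complex.ext
  all_goals simp
  all_goals ring

/-- Composing `f` with the retraction x ↦ x - ρ(x) e gives zero near `p`; the chain rule then makes
df a multiple of dρ. Hence ρ alone determines the tangent space. -/
theorem fderiv_of_vanishing (h : IsDefinedBy M Ω ρ Θ e)
    {p : Cspace N} (hp : p ∈ M) {U : Set (Cspace N)} (hU : IsOpen U)
    (hpU : p ∈ U) {f : Cspace N → ℝ} (hf : ContDiffOn ℝ ∞ f U) (h0 : ∀ x ∈ M ∩ U, f x = 0)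
    (v : Cspace N) : fderiv ℝ f p v = fderiv ℝ f p e * fderiv ℝ ρ p v := by
  have hr : HasFDerivAt (fun x => x - ρ x • e)
      (ContinuousLinearMap.id ℝ (Cspace N) - (fderiv ℝ ρ p).smulRight e) p :=
    (hasFDerivAt_id p).sub ((h.differentiableAt hp).hasFDerivAt.smul_const e)
  have hrp : p - ρ p • e = p := by rw [h.apply_eq_zero hp]; simp
  have hf' : HasFDerivAt f (fderiv ℝ f p) (p - ρ p • e) := by
    rw [hrp]
    exact ((hf.contDiffAt (hU.mem_nhds hpU)).differentiableAt (by simp)).hasFDerivAt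
  have hc := hf'.comp p hr
  have hz : f ∘ (fun x => x - ρ x • e) =ᶠ[nhds p] fun _ => (0 : ℝ) := by
    have h1 : ∀ᶠ x in nhds p, x ∈ Ω := h.isOpen.mem_nhds (h.mem_domain hp)
    have h2 : ∀ᶠ x in nhds p, x - ρ x • e ∈ U :=
      hr.continuousAt.eventually (by simp only [hrp]; exact hU.mem_nhds hpU)
    filter_upwards [h1, h2] with x hx1 hx2
    exact h0 _ ⟨h.retract x hx1, hx2⟩
  have hd := (hc.congr_of_eventuallyEq hz.symm).unique (hasFDerivAt_const (0 : ℝ) p)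
  have := congrArg (fun L : Cspace N →L[ℝ] ℝ => L v) hd
  simp only [ContinuousLinearMap.comp_apply, _root_.sub_apply,
    ContinuousLinearMap.id_apply, ContinuousLinearMap.smulRight_apply, map_sub, map_smul,
    smul_eq_mul, _root_.zero_apply] at this
  linarith

theorem mem_ctangent (h : IsDefinedBy M Ω ρ Θ e) {p : Cspace N} (hp : p ∈ M) {Z : CVec N} :
    Z ∈ ctangent M p ↔ Θ p Z.1 + star (Θ p (star Z.2)) = 0 := by
  have key := h.cderiv_eq hp Z
  constructor
  · intro hZ
    have h0 := hZ Ω ρ h.isOpen (h.mem_domain hp) h.smooth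
      (fun x hx => h.apply_eq_zero hx.1)
    rw [key] at h0
    simpa using h0
  · intro hZ U f hU hpU hf h0
    have hd : DifferentiableAt ℝ f p :=
      (hf.contDiffAt (hU.mem_nhds hpU)).differentiableAt (by simp)
    rw [hZ, mul_zero, cderiv_ofReal (h.differentiableAt hp)] at key
    rw [cderiv_ofReal hd, h.fderiv_of_vanishing hp hU hpU hf h0,
      h.fderiv_of_vanishing hp hU hpU hf h0 ((1 / (2 * Complex.I) : ℂ) • (Z.1 - star Z.2))]
    push_cast
    linear_combination (fderiv ℝ f p e : ℂ) * key

theorem mem_crSpace (h : IsDefinedBy M Ω ρ Θ e) {p : Cspace N} (hp : p ∈ M) {a : Cspace N} :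
    a ∈ crSpace M p ↔ Θ p a = 0 := by
  unfold crSpace
  rw [Submodule.mem_comap, h.mem_ctangent hp]
  simp

theorem mem_crSpaceBar (h : IsDefinedBy M Ω ρ Θ e) {p : Cspace N} (hp : p ∈ M) {b : Cspace N} :
    b ∈ crSpaceBar M p ↔ Θ p (star b) = 0 := by
  unfold crSpaceBar
  rw [Submodule.mem_comap, h.mem_ctangent hp]
  simp

theorem star_mem_ctangent (h : IsDefinedBy M Ω ρ Θ e)
    {p : Cspace N} (hp : p ∈ M) {a : Cspace N} (ha : a ∈ crSpace M p) :
    ((0, star a) : CVec N) ∈ ctangent M p := by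
  rw [h.mem_ctangent hp]
  simp [(h.mem_crSpace hp).1 ha]

/-- The function Θ(X) vanishes on `M`, so its derivative along a tangent (0,1)-vector is zero; the
Leibniz rule moves the derivative from X to Θ. Brackets modulo CR directions thus depend only on the
values of the sections at `p`. -/
theorem form_cderiv_section (h : IsDefinedBy M Ω ρ Θ e)
    {p : Cspace N} (hp : p ∈ M) {X : Cspace N → Cspace N}
    (hX : IsSectionNear M (crSpace M) p X) {b : Cspace N} (hb : b ∈ crSpace M p) :
    Θ p (cderiv X p (0, star b)) = -cderiv Θ p (0, star b) (X p) := by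
  have hXd := hX.differentiableAt
  obtain ⟨U, hU, hpU, hXs, hXm⟩ := hX
  have hsm : ContDiffOn ℝ ∞ (fun x => Θ x (X x)) (U ∩ Ω) := by
    have h1 : ContDiffOn ℝ ∞ (fun x => (Θ x).restrictScalars ℝ) (U ∩ Ω) :=
      (ContinuousLinearMap.restrictScalarsL ℂ (Cspace N) ℂ ℝ ℝ).contDiff.comp_contDiffOn
        (h.smooth_form.mono Set.inter_subset_right)
    exact h1.clm_apply (hXs.mono Set.inter_subset_left)
  have h0 := cderiv_eq_zero_of_vanishing (h.star_mem_ctangent hp hb) (hU.inter h.isOpen)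
    ⟨hpU, h.mem_domain hp⟩ hsm
    (fun x hx => (h.mem_crSpace hx.1).1 (hXm x ⟨hx.1, hx.2.1⟩))
  rw [cderiv_clm_apply (h.differentiableAt_form hp) hXd] at h0
  linear_combination h0

/-- The bracket of sections of the CR bundle lies in the CR directions, up to a prescribed
vector, if and only if the corresponding values of the Levi form agree. -/
theorem bracket_sub_mem_iff (h : IsDefinedBy M Ω ρ Θ e)
    {p : Cspace N} (hp : p ∈ M) {X Y : Cspace N → Cspace N}
    (hX : IsSectionNear M (crSpace M) p X) (hY : IsSectionNear M (crSpace M) p Y) (c : CVec N) :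
    bracket (holField X) (conjField Y) p - c ∈ (crSpace M p).prod (crSpaceBar M p) ↔
      cderiv Θ p (0, star (Y p)) (X p) = Θ p c.1 ∧
      cderiv Θ p (0, star (X p)) (Y p) = -Θ p (star c.2) := by
  rw [bracket_hol_conj hX.differentiableAt hY.differentiableAt, Submodule.mem_prod,
    h.mem_crSpace hp, h.mem_crSpaceBar hp]
  simp only [Prod.fst_sub, Prod.snd_sub, map_sub, map_neg, star_sub, star_star,
    h.form_cderiv_section hp hX (hY.mem hp), h.form_cderiv_section hp hY (hX.mem hp)]
  constructor
  · rintro ⟨h1, h2⟩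
    exact ⟨by linear_combination h1, by linear_combination -h2⟩
  · rintro ⟨h1, h2⟩
    exact ⟨by linear_combination h1, by linear_combination -h2⟩

theorem bracket_mem_iff (h : IsDefinedBy M Ω ρ Θ e)
    {p : Cspace N} (hp : p ∈ M) {X Y : Cspace N → Cspace N}
    (hX : IsSectionNear M (crSpace M) p X) (hY : IsSectionNear M (crSpace M) p Y) :
    bracket (holField X) (conjField Y) p ∈ (crSpace M p).prod (crSpaceBar M p) ↔
      cderiv Θ p (0, star (Y p)) (X p) = 0 ∧ cderiv Θ p (0, star (X p)) (Y p) = 0 := by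
  have := h.bracket_sub_mem_iff hp hX hY 0
  simpa using this

end IsDefinedBy

/-- A map which is holomorphic on the whole space and preserves `M` is a CR map of `M`. -/
theorem isCRMap_of_contDiff {φ : Cspace N → Cspace N} (hφ : ContDiff ℂ ∞ φ)
    (hM : Set.MapsTo φ M M) : IsCRMap M φ := by
  have hφr : ContDiff ℝ ∞ φ := hφ.restrict_scalars ℝ
  have hder : ∀ p, HasFDerivAt φ ((fderiv ℂ φ p).restrictScalars ℝ) p := fun p =>
    ((hφ.differentiable (by simp)) p).hasFDerivAt.restrictScalars ℝ
  have hlin : ∀ p a, cderiv φ p (a, 0) = fderiv ℂ φ p a := by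
    intro p a
    rw [cderiv_inl, (hder p).fderiv]
    simp only [ContinuousLinearMap.coe_restrictScalars', map_smul, smul_smul, Complex.I_mul_I]
    module
  refine ⟨⟨Set.univ, isOpen_univ, Set.subset_univ _, hφr.contDiffOn⟩, hM, fun p hp a ha => ?_⟩
  constructor
  · rw [hlin]
    intro U f hU hpU hf h0
    have h1 := ha (φ ⁻¹' U) (f ∘ φ) (hU.preimage hφr.continuous) hpU
      (hf.comp hφr.contDiffOn (fun x hx => hx)) (fun x hx => h0 _ ⟨hM hx.1, hx.2⟩)
    have hfd : DifferentiableAt ℝ (fun y => (f y : ℂ)) (φ p) :=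
      ((Complex.ofRealCLM.contDiff.comp_contDiffOn hf).contDiffAt
        (hU.mem_nhds hpU)).differentiableAt (by simp)
    have hc : HasFDerivAt (fun x => ((f ∘ φ) x : ℂ))
        ((fderiv ℝ (fun y => (f y : ℂ)) (φ p)).comp ((fderiv ℂ φ p).restrictScalars ℝ)) p :=
      hfd.hasFDerivAt.comp p (hder p)
    change cderiv _ p (a, 0) = 0 at h1
    change cderiv _ (φ p) (_, 0) = 0
    rw [cderiv_inl, hc.fderiv] at h1
    simp only [ContinuousLinearMap.comp_apply, ContinuousLinearMap.coe_restrictScalars',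
      map_smul] at h1
    exact (cderiv_inl _ _ _).trans h1
  · rw [cderiv_star (hder p).differentiableAt, cderiv_inr, (hder p).fderiv]
    simp only [ContinuousLinearMap.coe_restrictScalars', map_smul, smul_smul, Complex.I_mul_I,
      star_star]
    simp

/-- A hypersurface whose CR symbol at each point has a nonzero antilinear part is
2-nondegenerate. -/
theorem isTwoNondegenerate_of_hasCRSymbol {m : ℕ} {H A : Matrix (Fin m) (Fin m) ℂ}
    (hA : A ≠ 0) (hM : ∀ p ∈ M, HasCRSymbol M p H A) : IsTwoNondegenerate M 1 := by
  refine ⟨le_rfl, fun p hp => ?_⟩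
  obtain ⟨X, V, τ, hX, hV, hli, -, hspan, -, -, -, had⟩ := hM p hp
  have hV0 : V p ≠ 0 := hli.ne_zero 0
  refine ⟨by rw [← hspan]; exact finrank_span_singleton hV0, fun v hv hbr => ?_⟩
  rw [← hspan] at hv
  obtain ⟨c, rfl⟩ := Submodule.mem_span_singleton.1 hv
  by_contra hc
  have hc0 : c ≠ 0 := fun h => hc (by simp [h])
  apply hA
  ext j k
  have h1 := hbr (fun x => c • V x) (X k) (hV.const_smul c) (hX k) rfl
  have hVd := hV.differentiableAt
  have hcV : ∀ Z, cderiv (fun x => c • V x) p Z = c • cderiv V p Z := by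
    intro Z
    have : HasFDerivAt (fun x => c • V x) (c • fderiv ℝ V p) p := hVd.hasFDerivAt.const_smul c
    unfold cderiv
    rw [this.fderiv, complexify_apply, complexify_apply]
    simp only [ContinuousLinearMap.coe_coe, _root_.smul_apply]
    module
  have h2 := had k
  rw [bracket_hol_conj (X := fun x => c • V x) (hVd.const_smul c) (hX k).differentiableAt, Submodule.mem_prod] at h1
  rw [bracket_hol_conj hVd (hX k).differentiableAt, Submodule.mem_prod] at h2
  have h1' := h1.1
  have h2' := h2.1
  simp only [Prod.fst_sub, hcV] at h1' h2'
  -- After dividing by `c`, the two memberships differ exactly by column `k` of `A`, which linear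
  -- independence modulo `V p` then forces to vanish.
  have h3 : ∑ j, A j k • X j p ∈ leviKernel M p := by
    have := (leviKernel M p).sub_mem ((leviKernel M p).smul_mem c⁻¹ h1') h2'
    rw [smul_neg, smul_smul, inv_mul_cancel₀ hc0, one_smul] at this
    simpa using this
  rw [← hspan] at h3
  obtain ⟨d, hd⟩ := Submodule.mem_span_singleton.1 h3
  rw [Fintype.linearIndependent_iff] at hli
  have h4 := hli (Fin.cons d (fun j => -A j k)) (by
    rw [Fin.sum_univ_succ]
    simp [hd]) j.succ
  simpa using h4

end Hypersurface

end CRGeom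

namespace CRGeom

/-! ### Gradings for which a nilpotent operator has degree one. -/

section Grading

theorem exists_trace_mul_eq {n : Type*} [Fintype n] [DecidableEq n]
    (φ : Matrix n n ℝ →ₗ[ℝ] ℝ) : ∃ Z : Matrix n n ℝ, ∀ X, φ X = (Z * X).trace := by
  refine ⟨Matrix.of fun i j => φ (Matrix.single j i 1), fun X => ?_⟩
  conv_lhs => rw [Matrix.matrix_eq_sum_single X]
  simp only [map_sum, Matrix.trace, Matrix.diag, Matrix.mul_apply, Matrix.of_apply]
  rw [Finset.sum_comm]
  refine Finset.sum_congr rfl fun i _ => Finset.sum_congr rfl fun j _ => ?_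
  rw [show Matrix.single j i (X j i) = X j i • Matrix.single j i (1 : ℝ) by simp, map_smul,
    smul_eq_mul, mul_comm]

/-- A nilpotent matrix has degree one with respect to some grading. -/
theorem exists_grading_matrix {n : Type*} [Fintype n] [DecidableEq n] {N : Matrix n n ℝ}
    (hN : IsNilpotent N) : ∃ h : Matrix n n ℝ, h * N - N * h = N := by
  let ad : Matrix n n ℝ →ₗ[ℝ] Matrix n n ℝ := LinearMap.mulRight ℝ N - LinearMap.mulLeft ℝ N
  by_contra hne
  have hmem : N ∉ LinearMap.range ad := fun ⟨h, hh⟩ => hne ⟨h, hh⟩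
  obtain ⟨φ, hφ, hle⟩ := Submodule.exists_le_ker_of_notMem hmem
  obtain ⟨Z, hZ⟩ := exists_trace_mul_eq φ
  -- By invariance of the trace, tr(Z ·) kills all commutators with N precisely when Z commutes with
  -- N; then ZN is nilpotent and φ(N) = tr(ZN) = 0.
  have hcomm : N * Z = Z * N := by
    rw [Matrix.ext_iff_trace_mul_right]
    intro X
    have h1 : φ (X * N - N * X) = 0 := hle ⟨X, rfl⟩
    rw [hZ, mul_sub, Matrix.trace_sub, ← mul_assoc, ← mul_assoc, Matrix.trace_mul_comm,
      ← mul_assoc] at h1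
    exact sub_eq_zero.1 h1
  have h2 : IsNilpotent (Z * N) := Commute.isNilpotent_mul_left hcomm.symm hN
  exact hφ (by rw [hZ]; exact (Matrix.isNilpotent_trace_of_isNilpotent h2).eq_zero)

theorem exists_grading_end {V : Type*} [AddCommGroup V] [Module ℝ V]
    [FiniteDimensional ℝ V] {N : Module.End ℝ V} (hN : IsNilpotent N) :
    ∃ h : Module.End ℝ V, h * N - N * h = N := by
  let b := Module.finBasis ℝ V
  let e := LinearMap.toMatrixAlgEquiv b
  obtain ⟨h, hh⟩ := exists_grading_matrix (hN.map e)
  refine ⟨e.symm h, e.injective ?_⟩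
  rw [map_sub, map_mul, map_mul, AlgEquiv.apply_symm_apply, hh]

end Grading

/-! ### Truncated series of cos + sin at a nilpotent element. -/

section TrigSum

/-- The sign of the `k`-th coefficient of `cos + sin`. -/
noncomputable def trigSign (k : ℕ) : ℝ := if k % 4 < 2 then 1 else -1

/-- On coefficients this is (cos + sin)'(x) = (cos + sin)(-x). -/
theorem trigSign_succ (k : ℕ) : trigSign (k + 1) = (-1) ^ k * trigSign k := by
  unfold trigSign
  rw [← Nat.div_add_mod k 4, pow_add, pow_mul]
  have h := Nat.mod_lt k (show 0 < 4 by norm_num)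
  generalize k / 4 = d
  generalize k % 4 = r at h
  interval_cases r <;> norm_num [Nat.add_mod, Nat.mul_mod]

/-- The truncated power series of `cos (η x) + sin (η x)`. -/
noncomputable def trigSum (K : ℕ) {A : Type*} [Ring A] [Algebra ℝ A] (x : A) (η : ℝ) : A :=
  ∑ k ∈ Finset.range K, (trigSign k * η ^ k / k.factorial) • x ^ k

section Algebra

variable {A : Type*} [Ring A] [Algebra ℝ A]

theorem trigSum_neg (K : ℕ) (x : A) (η : ℝ) : trigSum K x (-η) = trigSum K (-x) η := by
  unfold trigSum
  refine Finset.sum_congr rfl fun k _ => ?_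
  rw [neg_pow η, neg_pow x, ← mul_smul_comm]
  rcases neg_one_pow_eq_or ℝ k with h | h
  · have : (-1 : A) ^ k = 1 := by
      have := congrArg (algebraMap ℝ A) h; simpa using this
    simp [h, this]
  · have : (-1 : A) ^ k = -1 := by
      have := congrArg (algebraMap ℝ A) h; simpa using this
    simp [h, this, neg_div]

theorem commute_trigSum {y x : A} (h : Commute y x) (K : ℕ) (η : ℝ) :
    Commute y (trigSum K x η) :=
  Commute.sum_right _ _ _ fun k _ => (h.pow_right k).smul_right _

theorem semiconj_trigSum {j x y : A} (h : SemiconjBy j x y) (K : ℕ) (η : ℝ) :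
    SemiconjBy j (trigSum K x η) (trigSum K y η) := by
  unfold SemiconjBy trigSum
  rw [Finset.mul_sum, Finset.sum_mul]
  refine Finset.sum_congr rfl fun k _ => ?_
  rw [mul_smul_comm, smul_mul_assoc, (h.pow_right k).eq]

theorem map_trigSum {B : Type*} [Ring B] [Algebra ℝ B] (f : A →ₐ[ℝ] B) (K : ℕ) (x : A) (η : ℝ) :
    f (trigSum K x η) = trigSum K (f x) η := by
  simp [trigSum]

theorem trigSum_smul (K : ℕ) (x : A) (r η : ℝ) : trigSum K (r • x) η = trigSum K x (r * η) := by
  unfold trigSum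
  refine Finset.sum_congr rfl fun k _ => ?_
  rw [smul_pow, smul_smul]
  congr 1
  ring

theorem trigSum_zero {K : ℕ} (hK : 0 < K) (x : A) : trigSum K x 0 = 1 := by
  obtain ⟨K, rfl⟩ := Nat.exists_eq_add_of_lt hK
  unfold trigSum
  rw [zero_add, Finset.sum_range_succ']
  simp [trigSign]

/-- The constant term is 1 and the remaining terms are a nilpotent multiple of x. -/
theorem isUnit_trigSum {K : ℕ} (hK : 0 < K) {x : A} (hx : IsNilpotent x) (η : ℝ) :
    IsUnit (trigSum K x η) := by
  obtain ⟨K, rfl⟩ := Nat.exists_eq_add_of_lt hK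
  unfold trigSum
  rw [zero_add, Finset.sum_range_succ']
  simp only [pow_zero, trigSign, Nat.zero_mod, Nat.ofNat_pos, ite_true, Nat.factorial_zero,
    Nat.cast_one, mul_one, div_one, one_smul]
  refine IsNilpotent.isUnit_add_one ?_
  have : ∀ k, (trigSign (k + 1) * η ^ (k + 1) / (k + 1).factorial) • x ^ (k + 1) =
      x * ((trigSign (k + 1) * η ^ (k + 1) / (k + 1).factorial) • x ^ k) := by
    intro k; rw [mul_smul_comm, ← pow_succ' x]
  simp only [trigSign] at this
  simp only [this, ← Finset.mul_sum]
  refine Commute.isNilpotent_mul_right ?_ hx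
  exact Commute.sum_right _ _ _ fun k _ => ((Commute.refl x).pow_right k).smul_right _

end Algebra

section Normed

variable {A : Type*} [NormedRing A] [NormedAlgebra ℝ A]

theorem contDiff_trigSum (K : ℕ) (x : A) : ContDiff ℝ ∞ (trigSum K x) := by
  unfold trigSum
  fun_prop

theorem hasDerivAt_trigSum {K : ℕ} {x : A} (hx : x ^ K = 0) (η : ℝ) :
    HasDerivAt (trigSum K x) (x * trigSum K x (-η)) η := by
  have h1 : HasDerivAt (trigSum K x)
      (∑ k ∈ Finset.range K, (trigSign k * (k * η ^ (k - 1)) / k.factorial) • x ^ k) η := by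
    unfold trigSum
    refine HasDerivAt.fun_sum fun k _ => ?_
    exact (((hasDerivAt_pow k η).const_mul _).div_const _).smul_const _
  convert h1 using 1
  rcases K with _ | K
  · simp [trigSum]
  · rw [Finset.sum_range_succ', trigSum, Finset.sum_range_succ, mul_add, mul_smul_comm,
      ← pow_succ', hx, Finset.mul_sum]
    simp only [CharP.cast_eq_zero, zero_mul, mul_zero, zero_div, zero_smul, add_zero, smul_zero]
    refine Finset.sum_congr rfl fun k _ => ?_
    rw [mul_smul_comm, ← pow_succ', trigSign_succ, Nat.factorial_succ, neg_pow η]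
    congr 1
    have : (k.factorial : ℝ) ≠ 0 := by positivity
    push_cast
    field_simp

theorem hasDerivAt_trigSum_neg {K : ℕ} {x : A} (hx : x ^ K = 0) (η : ℝ) :
    HasDerivAt (fun t => trigSum K x (-t)) (-(x * trigSum K x η)) η := by
  have := (hasDerivAt_trigSum hx (-η)).scomp η (hasDerivAt_neg η)
  simpa [Function.comp_def] using this

/-- This is (cos + sin)² + (cos - sin)² = 2: the left side has zero derivative in η and equals 2 at
η = 0. -/
theorem trigSum_sq_add_sq {K : ℕ} (hK : 0 < K) {x : A} (hx : x ^ K = 0) (η : ℝ) :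
    trigSum K x η * trigSum K x η + trigSum K x (-η) * trigSum K x (-η) = 2 := by
  have hd : ∀ t, HasDerivAt
      (fun t => trigSum K x t * trigSum K x t + trigSum K x (-t) * trigSum K x (-t)) 0 t := by
    intro t
    have h1 := hasDerivAt_trigSum hx t
    have h2 := hasDerivAt_trigSum_neg hx t
    refine ((h1.mul h1).add (h2.mul h2)).congr_deriv ?_
    have hc1 : Commute x (trigSum K x t) := commute_trigSum (Commute.refl x) K t
    have hc2 : Commute x (trigSum K x (-t)) := commute_trigSum (Commute.refl x) K (-t)
    have hc3 : Commute (trigSum K x t) (trigSum K x (-t)) := commute_trigSum hc1.symm K (-t)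
    have e1 : trigSum K x t * (x * trigSum K x (-t)) = x * (trigSum K x (-t) * trigSum K x t) := by
      rw [← mul_assoc, ← hc1.eq, mul_assoc, hc3.eq]
    have e2 : trigSum K x (-t) * (x * trigSum K x t) = x * (trigSum K x (-t) * trigSum K x t) := by
      rw [← mul_assoc, ← hc2.eq, mul_assoc]
    rw [e1, neg_mul, mul_neg, e2, mul_assoc, mul_assoc, hc3.eq]
    abel
  have := is_const_of_deriv_eq_zero (fun t => (hd t).differentiableAt)
    (fun t => (hd t).deriv) η 0
  simp only [neg_zero, trigSum_zero hK] at this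
  rw [this]; norm_num

end Normed

open Polynomial in
/-- For an even polynomial `C`, the equation `q = X C(q)` has an odd solution modulo `X ^ n`. -/
theorem exists_odd_polynomial {C : ℝ[X]} (hC : C.comp (-X) = C) (n : ℕ) :
    ∃ q : ℝ[X], X ∣ q ∧ q.comp (-X) = -q ∧ X ^ n ∣ q - X * C.comp q := by
  induction n with
  | zero => exact ⟨0, by simp, by simp, by simp⟩
  | succ n ih =>
    obtain ⟨q, -, hodd, hq⟩ := ih
    refine ⟨X * C.comp q, dvd_mul_right _ _, ?_, ?_⟩
    · rw [mul_comp, X_comp, comp_assoc, hodd]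
      have : C.comp (-q) = C.comp q := by
        conv_rhs => rw [← hC, comp_assoc]
        simp
      rw [this]; ring
    -- The new q is X C(q). Differences of values of C are divisible by the difference of the
    -- arguments, and the outer factor X gains one power.
    · rw [pow_succ', ← mul_sub]
      refine mul_dvd_mul_left X (hq.trans ?_)
      simpa [comp_eq_aeval, aeval_def, eval₂_eq_eval_map] using
        Polynomial.sub_dvd_eval_sub q (X * C.comp q) (C.map Polynomial.C)

end TrigSum

end CRGeom

/-! ### Operator calculus for cos, sec and tan of `s`. -/

namespace CRGeom

/-- Real-linear operators of `ℂ^m`. -/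
abbrev ROp (m : ℕ) : Type := Cspace m →L[ℝ] Cspace m

noncomputable instance (m : ℕ) : NormedRing (ROp m) := ContinuousLinearMap.toNormedRing

noncomputable instance (m : ℕ) : NormedAlgebra ℝ (ROp m) := ContinuousLinearMap.toNormedAlgebra

noncomputable instance (m : ℕ) : SMul ℝ (ROp m) := Algebra.toSMul

noncomputable instance (m : ℕ) : Neg (ROp m) := NormedRing.toRing.toNeg

noncomputable instance (m : ℕ) : Sub (ROp m) := NormedRing.toRing.toSub

/-- The complex structure of `ℂ^m` as a real-linear operator. -/
noncomputable def mulI (m : ℕ) : ROp m := Complex.I • ContinuousLinearMap.id ℝ (Cspace m)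

theorem mulI_apply {m : ℕ} (x : Cspace m) : mulI m x = Complex.I • x := rfl

theorem mulI_mul_self {m : ℕ} : mulI m * mulI m = -1 := by
  ext1 x
  change Complex.I • Complex.I • x = -x
  rw [smul_smul, Complex.I_mul_I, neg_one_smul]

theorem map_complex_smul_of_commute {m : ℕ} {T : ROp m} (hT : Commute (mulI m) T) (c : ℂ)
    (x : Cspace m) : T (c • x) = c • T x := by
  have h3 : T (Complex.I • x) = Complex.I • T x :=
    (congrArg (fun T : ROp m => T x) hT.eq).symm
  have : ∀ y : Cspace m, c • y = c.re • y + c.im • (Complex.I • y) := fun y => by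
    rw [real_smul_eq_complex, real_smul_eq_complex, smul_smul, ← add_smul, Complex.re_add_im]
  rw [this, map_add, map_smul, map_smul, h3, ← this]

theorem contDiff_of_commute_mulI {m : ℕ} {T : ROp m} (hT : Commute (mulI m) T) :
    ContDiff ℂ ∞ T :=
  ({ T with map_smul' := map_complex_smul_of_commute hT } : Cspace m →L[ℂ] Cspace m).contDiff

/-- A nondegenerate Hermitian form `ell` on `ℂ^m` together with a nilpotent self-adjoint antilinear
operator `s` and a skew-adjoint complex-linear operator `h` for which `s` has degree one. -/
structure GradedForm (m : ℕ) where
  ell : Cspace m →L[ℝ] Cspace m →L[ℝ] ℂ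
  s : ROp m
  h : ROp m
  K : ℕ
  ell_I_left : ∀ x y, ell (Complex.I • x) y = Complex.I * ell x y
  ell_conj : ∀ x y, ell y x = star (ell x y)
  nondeg : ∀ x, (∀ y, ell x y = 0) → x = 0
  s_mulI : mulI m * s = -s * mulI m
  s_adj : ∀ x y, ell (s x) y = ell (s y) x
  K_pos : 0 < K
  s_pow : s ^ K = 0
  h_mulI : Commute (mulI m) h
  h_skew : ∀ x y, ell (h x) y = -ell x (h y)
  h_s : h * s - s * h = s

namespace GradedForm

variable {m : ℕ} (D : GradedForm m)

theorem ell_I_right (x y : Cspace m) : D.ell x (Complex.I • y) = -(Complex.I * D.ell x y) := by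
  rw [D.ell_conj, D.ell_I_left, D.ell_conj x y]; simp

theorem ell_smul_left (c : ℂ) (x y : Cspace m) : D.ell (c • x) y = c * D.ell x y := by
  have : c • x = c.re • x + c.im • (Complex.I • x) := by
    rw [real_smul_eq_complex, real_smul_eq_complex, smul_smul, ← add_smul, Complex.re_add_im]
  rw [this, map_add, map_smul, map_smul, add_apply, smul_apply, smul_apply, D.ell_I_left,
    Complex.real_smul, Complex.real_smul]
  conv_rhs => rw [← Complex.re_add_im c]
  ring

theorem ell_smul_right (c : ℂ) (x y : Cspace m) : D.ell x (c • y) = star c * D.ell x y := by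
  rw [D.ell_conj, D.ell_smul_left, D.ell_conj x y]; simp

theorem ell_im (x y : Cspace m) : (D.ell x y).im = (D.ell x (Complex.I • y)).re := by
  rw [D.ell_I_right]; simp

theorem ell_re_comm (x y : Cspace m) : (D.ell x y).re = (D.ell y x).re := by
  rw [D.ell_conj x y]; simp

/-- Self-adjointness with respect to the real part of the Hermitian form. -/
def IsSelfAdj (T : ROp m) : Prop := ∀ x y, (D.ell (T x) y).re = (D.ell x (T y)).re

variable {D}

theorem IsSelfAdj.mul {S T : ROp m} (hS : D.IsSelfAdj S) (hT : D.IsSelfAdj T)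
    (h : Commute S T) : D.IsSelfAdj (S * T) := fun x y => by
  rw [show D.ell x ((S * T) y) = D.ell x (T (S y)) by rw [h.eq]; rfl, ← hT, ← hS]; rfl

theorem IsSelfAdj.one : D.IsSelfAdj 1 := fun _ _ => rfl

theorem IsSelfAdj.pow {S : ROp m} (hS : D.IsSelfAdj S) (k : ℕ) : D.IsSelfAdj (S ^ k) := by
  induction k with
  | zero => exact IsSelfAdj.one
  | succ k ih => rw [pow_succ]; exact ih.mul hS ((Commute.refl S).pow_left k)

theorem IsSelfAdj.smul {S : ROp m} (hS : D.IsSelfAdj S) (r : ℝ) : D.IsSelfAdj (r • S) :=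
  fun x y => by
    simp only [smul_apply, map_smul, Complex.real_smul, Complex.re_ofReal_mul, hS x y]

theorem IsSelfAdj.sum {ι : Type*} {S : ι → ROp m} (t : Finset ι)
    (hS : ∀ i ∈ t, D.IsSelfAdj (S i)) : D.IsSelfAdj (∑ i ∈ t, S i) := fun x y => by
  simp only [_root_.sum_apply, map_sum, Complex.re_sum]
  exact Finset.sum_congr rfl fun i hi => hS i hi x y

theorem IsSelfAdj.inverse {S : ROp m} (hS : D.IsSelfAdj S) (hu : IsUnit S) :
    D.IsSelfAdj (Ring.inverse S) := fun x y => by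
  have h1 : ∀ z, S (Ring.inverse S z) = z := fun z =>
    congrArg (fun T : ROp m => T z) (Ring.mul_inverse_cancel S hu)
  conv_lhs => rw [← h1 y]
  conv_rhs => rw [← h1 x]
  exact (hS _ _).symm

/-- The imaginary part of ell(x, y) is the real part of ell(x, iy), so for complex-linear operators
the real identity gives the complex one. -/
theorem IsSelfAdj.ell_apply_of_commute {S : ROp m} (hS : D.IsSelfAdj S)
    (hc : Commute (mulI m) S) (x y : Cspace m) : D.ell (S x) y = D.ell x (S y) := by
  have h1 : S (Complex.I • y) = Complex.I • S y :=
    (congrArg (fun T : ROp m => T y) hc.eq).symm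
  apply Complex.ext (hS x y)
  rw [D.ell_im, D.ell_im, hS, h1]

variable (D)

theorem isSelfAdj_s : D.IsSelfAdj D.s := fun x y => by rw [D.s_adj, D.ell_re_comm]

/-- The operator `cos (η s) + sin (η s)`. -/
noncomputable def P (η : ℝ) : ROp m := trigSum D.K D.s η

theorem isNilpotent_s : IsNilpotent D.s := ⟨D.K, D.s_pow⟩

theorem isUnit_P (η : ℝ) : IsUnit (D.P η) := isUnit_trigSum D.K_pos D.isNilpotent_s η

theorem commute_s_P (η : ℝ) : Commute D.s (D.P η) := commute_trigSum (Commute.refl _) _ _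

theorem commute_P_P (η θ : ℝ) : Commute (D.P η) (D.P θ) := commute_trigSum (D.commute_s_P η).symm _ _

/-- Conjugation by i turns the antilinear `s` into -s. -/
theorem mulI_mul_P (η : ℝ) : mulI m * D.P η = D.P (-η) * mulI m := by
  have := semiconj_trigSum (show SemiconjBy (mulI m) D.s (-D.s) from D.s_mulI) D.K η
  rw [← trigSum_neg] at this
  exact this

theorem isSelfAdj_P (η : ℝ) : D.IsSelfAdj (D.P η) :=
  IsSelfAdj.sum _ fun k _ => (D.isSelfAdj_s.pow k).smul _

theorem isUnit_P_mul_P (η : ℝ) : IsUnit (D.P η * D.P (-η)) := (D.isUnit_P η).mul (D.isUnit_P (-η))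

/-- The operator `sec (2 η s)`. -/
noncomputable def sec (η : ℝ) : ROp m := Ring.inverse (D.P η * D.P (-η))

theorem sec_mul (η : ℝ) : D.sec η * (D.P η * D.P (-η)) = 1 :=
  Ring.inverse_mul_cancel _ (D.isUnit_P_mul_P η)

theorem mul_sec (η : ℝ) : (D.P η * D.P (-η)) * D.sec η = 1 :=
  Ring.mul_inverse_cancel _ (D.isUnit_P_mul_P η)

theorem commute_sec {T : ROp m} {η : ℝ} (h : Commute T (D.P η * D.P (-η))) :
    Commute T (D.sec η) := by
  have h1 : D.sec η * (T * (D.P η * D.P (-η))) * D.sec η =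
      D.sec η * ((D.P η * D.P (-η)) * T) * D.sec η := by rw [h.eq]
  have h2 : D.sec η * (T * (D.P η * D.P (-η))) * D.sec η = D.sec η * T := by
    rw [mul_assoc, mul_assoc, D.mul_sec, mul_one]
  have h3 : D.sec η * ((D.P η * D.P (-η)) * T) * D.sec η = T * D.sec η := by
    rw [← mul_assoc, D.sec_mul, one_mul]
  exact (h3.symm.trans (h1.symm.trans h2))

theorem commute_s_sec (η : ℝ) : Commute D.s (D.sec η) :=
  D.commute_sec ((D.commute_s_P η).mul_right (D.commute_s_P (-η)))

theorem commute_P_sec (η θ : ℝ) : Commute (D.P θ) (D.sec η) :=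
  D.commute_sec ((D.commute_P_P θ η).mul_right (D.commute_P_P θ (-η)))

/-- Moving i across cos(2ηs) = P(η) P(-η) merely swaps the two commuting factors. -/
theorem commute_mulI_sec (η : ℝ) : Commute (mulI m) (D.sec η) := by
  refine D.commute_sec ?_
  rw [commute_iff_eq, ← mul_assoc, D.mulI_mul_P, mul_assoc, D.mulI_mul_P, neg_neg, ← mul_assoc,
    (D.commute_P_P (-η) η).eq]

theorem isSelfAdj_sec (η : ℝ) : D.IsSelfAdj (D.sec η) :=
  ((D.isSelfAdj_P η).mul (D.isSelfAdj_P (-η)) (D.commute_P_P _ _)).inverse (D.isUnit_P_mul_P η)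

/-- The operator `sec (2 η s) + tan (2 η s)`. -/
noncomputable def E (η : ℝ) : ROp m := D.sec η * (D.P η * D.P η)

/-- In effect E = P(η) / P(-η). The derivative of E and the symmetry along leaves both rest on this
identity. -/
theorem E_mul_P_neg (η : ℝ) : D.E η * D.P (-η) = D.P η := by
  have h := (D.commute_P_P η (-η)).eq
  calc D.sec η * (D.P η * D.P η) * D.P (-η) = D.sec η * (D.P η * (D.P η * D.P (-η))) := by
        simp only [mul_assoc]
    _ = D.sec η * (D.P η * D.P (-η)) * D.P η := by
        conv_lhs => rw [h]
        simp only [mul_assoc]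
    _ = D.P η := by rw [D.sec_mul, one_mul]

theorem commute_s_E (η : ℝ) : Commute D.s (D.E η) :=
  (D.commute_s_sec η).mul_right ((D.commute_s_P η).mul_right (D.commute_s_P η))

theorem commute_P_E (η θ : ℝ) : Commute (D.P θ) (D.E η) :=
  (D.commute_P_sec η θ).mul_right ((D.commute_P_P θ η).mul_right (D.commute_P_P θ η))

theorem commute_sec_E (η : ℝ) : Commute (D.sec η) (D.E η) :=
  (Commute.refl _).mul_right ((D.commute_P_sec η η).symm.mul_right (D.commute_P_sec η η).symm)

theorem isSelfAdj_E (η : ℝ) : D.IsSelfAdj (D.E η) :=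
  (D.isSelfAdj_sec η).mul ((D.isSelfAdj_P η).mul (D.isSelfAdj_P η) (Commute.refl _))
    ((D.commute_P_sec η η).symm.mul_right (D.commute_P_sec η η).symm)

theorem P_mul_self_add (η : ℝ) : D.P η * D.P η + D.P (-η) * D.P (-η) = 2 :=
  trigSum_sq_add_sq D.K_pos D.s_pow η

/-- The factor 2 sec - E is sec - tan: passing i through E flips its antilinear part tan. -/
theorem mulI_mul_E (η : ℝ) : mulI m * D.E η = (2 * D.sec η - D.E η) * mulI m := by
  have h1 : D.P (-η) * D.P (-η) = 2 - D.P η * D.P η := eq_sub_of_add_eq' (D.P_mul_self_add η)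
  unfold E
  rw [← mul_assoc, (D.commute_mulI_sec η).eq, mul_assoc, ← mul_assoc (mulI m), D.mulI_mul_P,
    mul_assoc (D.P (-η)), D.mulI_mul_P, ← mul_assoc (D.P (-η)), h1, ← mul_assoc, mul_sub,
    mul_two, two_mul]

theorem E_mul_self_add_one (η : ℝ) : 1 + D.E η * D.E η = 2 * (D.sec η * D.E η) := by
  have hu : IsUnit (D.P (-η) * D.P (-η)) := (D.isUnit_P _).mul (D.isUnit_P _)
  apply hu.mul_left_injective
  change (1 + D.E η * D.E η) * (D.P (-η) * D.P (-η)) =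
    2 * (D.sec η * D.E η) * (D.P (-η) * D.P (-η))
  have h1 : D.E η * D.E η * (D.P (-η) * D.P (-η)) = D.P η * D.P η := by
    rw [mul_assoc, ← mul_assoc (D.E η) (D.P (-η)), D.E_mul_P_neg, ← mul_assoc,
      ← (D.commute_P_E η η).eq, mul_assoc, D.E_mul_P_neg]
  have h2 : D.sec η * D.E η * (D.P (-η) * D.P (-η)) = 1 := by
    rw [mul_assoc, ← mul_assoc (D.E η) (D.P (-η)), D.E_mul_P_neg, D.sec_mul]
  rw [add_mul, h1, mul_assoc 2, h2, one_mul, mul_one, add_comm, D.P_mul_self_add]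

theorem contDiff_P : ContDiff ℝ ∞ D.P := contDiff_trigSum _ _

theorem contDiff_sec : ContDiff ℝ ∞ D.sec := by
  rw [contDiff_iff_contDiffAt]
  intro η
  obtain ⟨u, hu⟩ := D.isUnit_P_mul_P η
  have h1 : ContDiffAt ℝ ∞ (fun η => D.P η * D.P (-η)) η :=
    (D.contDiff_P.mul (D.contDiff_P.comp contDiff_neg)).contDiffAt
  have h2 : ContDiffAt ℝ ∞ Ring.inverse (D.P η * D.P (-η)) := by
    rw [← hu]; exact contDiffAt_ringInverse ℝ u
  exact h2.comp η h1

theorem contDiff_E : ContDiff ℝ ∞ D.E := D.contDiff_sec.mul (D.contDiff_P.mul D.contDiff_P)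

/-- The derivative `s (1 + E ^ 2)` of `E`. -/
noncomputable def Ederiv (η : ℝ) : ROp m := D.s * (1 + D.E η * D.E η)

theorem Ederiv_eq (η : ℝ) : D.Ederiv η = (2 : ℝ) • (D.s * (D.sec η * D.E η)) := by
  rw [Ederiv, D.E_mul_self_add_one, two_mul, two_smul, mul_add]

theorem contDiff_Ederiv : ContDiff ℝ ∞ D.Ederiv :=
  contDiff_const.mul (contDiff_const.add (D.contDiff_E.mul D.contDiff_E))

/-- Differentiate E(η) P(-η) = P(η) and cancel the invertible factor P(-η). -/
theorem hasDerivAt_E (η : ℝ) : HasDerivAt D.E (D.Ederiv η) η := by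
  have hd : DifferentiableAt ℝ D.E η := D.contDiff_E.contDiffAt.differentiableAt (by simp)
  have h1 := hd.hasDerivAt.mul (hasDerivAt_trigSum_neg D.s_pow η)
  have h2 : (D.E * fun t => trigSum D.K D.s (-t)) = D.P := funext fun t => D.E_mul_P_neg t
  rw [h2] at h1
  have h3 : deriv D.E η * D.P (-η) + D.E η * -(D.s * D.P η) = D.s * D.P (-η) :=
    h1.unique (hasDerivAt_trigSum D.s_pow η)
  have h4 : deriv D.E η = D.Ederiv η := by
    apply (D.isUnit_P (-η)).mul_left_injective
    change deriv D.E η * D.P (-η) = D.Ederiv η * D.P (-η)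
    have h5 : D.E η * (D.s * D.P η) = D.s * (D.E η * D.E η) * D.P (-η) := by
      rw [← mul_assoc, ← (D.commute_s_E η).eq, mul_assoc, mul_assoc, mul_assoc, D.E_mul_P_neg]
    rw [Ederiv, mul_add, mul_one, add_mul, ← h5, ← h3, mul_neg]
    abel
  rw [← h4]; exact hd.hasDerivAt

/-- The second derivative of `E`. -/
noncomputable def Ederiv2 (η : ℝ) : ROp m := (4 : ℝ) • (D.s * D.s * (D.sec η * (D.E η * D.E η)))

theorem hasDerivAt_Ederiv (η : ℝ) : HasDerivAt D.Ederiv (D.Ederiv2 η) η := by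
  have h := D.hasDerivAt_E η
  refine (((h.mul h).const_add 1).const_mul D.s).congr_deriv ?_
  have hc : D.E η * D.Ederiv η = D.Ederiv η * D.E η := by
    have : Commute (D.E η) (D.Ederiv η) := (D.commute_s_E η).symm.mul_right
      ((Commute.one_right _).add_right ((Commute.refl _).mul_right (Commute.refl _)))
    exact this.eq
  rw [hc, D.Ederiv_eq, Ederiv2, ← two_smul ℝ]
  simp only [smul_mul_assoc, mul_smul_comm, smul_smul, mul_assoc]
  norm_num

theorem isSelfAdj_Ederiv (η : ℝ) : D.IsSelfAdj (D.Ederiv η) := by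
  have h1 : D.IsSelfAdj (D.E η * D.E η) :=
    (D.isSelfAdj_E η).mul (D.isSelfAdj_E η) (Commute.refl _)
  refine D.isSelfAdj_s.mul (fun x y => ?_)
    ((Commute.one_right _).add_right ((D.commute_s_E η).mul_right (D.commute_s_E η)))
  simp only [add_apply, map_add, Complex.add_re, h1 x y, IsSelfAdj.one x y]

theorem E_apply_I (η : ℝ) (x : Cspace m) :
    D.E η (Complex.I • x) = Complex.I • (2 • D.sec η x - D.E η x) := by
  have h1 := congrArg (fun T : ROp m => T x) (D.mulI_mul_E η)
  have h2 : Complex.I • D.E η x = 2 • D.sec η (Complex.I • x) - D.E η (Complex.I • x) := by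
    rw [two_mul] at h1; rw [two_smul]; exact h1
  have h3 : D.sec η (Complex.I • x) = Complex.I • D.sec η x :=
    (congrArg (fun T : ROp m => T x) (D.commute_mulI_sec η).eq).symm
  rw [h3] at h2
  rw [smul_sub, h2]
  module

theorem sec_apply_smul (η : ℝ) (c : ℂ) (x : Cspace m) : D.sec η (c • x) = c • D.sec η x :=
  map_complex_smul_of_commute (D.commute_mulI_sec η) c x

theorem s_apply_smul (c : ℂ) (x : Cspace m) : D.s (c • x) = star c • D.s x := by
  have h3 : D.s (Complex.I • x) = -(Complex.I • D.s x) := by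
    have := congrArg (fun T : ROp m => T x) D.s_mulI
    change Complex.I • D.s x = -D.s (Complex.I • x) at this
    rw [this, neg_neg]
  have : ∀ y : Cspace m, c • y = c.re • y + c.im • (Complex.I • y) := fun y => by
    rw [real_smul_eq_complex, real_smul_eq_complex, smul_smul, ← add_smul, Complex.re_add_im]
  rw [this, map_add, map_smul, map_smul, h3, real_smul_eq_complex, real_smul_eq_complex,
    smul_neg, smul_smul, ← sub_eq_add_neg, ← sub_smul]
  congr 1
  apply Complex.ext <;> simp

/-! ### Dilations generated by the grading. -/

section Scaling

/-- The one-parameter group generated by `h`. -/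
noncomputable def U (t : ℝ) : ROp m := NormedSpace.exp (t • D.h)

theorem U_mul_U_neg (t : ℝ) : D.U t * D.U (-t) = 1 := by
  let _ := NormedAlgebra.restrictScalars ℚ ℝ (ROp m)
  unfold U
  rw [neg_smul, ← NormedSpace.exp_add_of_commute (Commute.neg_right (Commute.refl _)),
    add_neg_cancel, NormedSpace.exp_zero]

theorem commute_mulI_U (t : ℝ) : Commute (mulI m) (D.U t) :=
  (D.h_mulI.smul_right t).exp_right

theorem hasDerivAt_U (t : ℝ) : HasDerivAt D.U (D.h * D.U t) t :=
  hasDerivAt_exp_smul_const' D.h t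

theorem ell_U (t : ℝ) (x y : Cspace m) : D.ell (D.U t x) (D.U t y) = D.ell x y := by
  have hv : ∀ z t, HasDerivAt (fun t => D.U t z) (D.h (D.U t z)) t := fun z t =>
    (D.hasDerivAt_U t).clm_apply (hasDerivAt_const t z) |>.congr_deriv (by simp)
  have hd : ∀ t, HasDerivAt (fun t => D.ell (D.U t x) (D.U t y)) 0 t := by
    intro t
    have h1 : HasDerivAt (fun t => D.ell (D.U t x)) (D.ell (D.h (D.U t x))) t :=
      D.ell.hasFDerivAt.comp_hasDerivAt t (hv x t)
    refine (h1.clm_apply (hv y t)).congr_deriv ?_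
    rw [D.h_skew]; simp
  have := is_const_of_deriv_eq_zero (fun t => (hd t).differentiableAt) (fun t => (hd t).deriv) t 0
  simpa [U, NormedSpace.exp_zero] using this

/-- Since [h, s] = s, the operator e^t U(-t) s U(t) is constant in t. Rescaling `s` therefore
amounts to rescaling η, for every series in ηs. -/
theorem s_mul_U (t : ℝ) : D.U t * (Real.exp (-t) • D.s) = D.s * D.U t := by
  have hd : ∀ t, HasDerivAt (fun t => Real.exp t • (D.U (-t) * D.s * D.U t)) 0 t := by
    intro t
    have h1 : HasDerivAt (fun t => D.U (-t)) (-(D.U (-t) * D.h)) t := by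
      have : HasDerivAt D.U (D.U (-t) * D.h) (-t) := hasDerivAt_exp_smul_const D.h (-t)
      simpa [Function.comp_def] using this.scomp t (hasDerivAt_neg t)
    refine ((Real.hasDerivAt_exp t).smul
      ((h1.mul_const D.s).mul (D.hasDerivAt_U t))).congr_deriv ?_
    rw [← smul_add]
    have : -(D.U (-t) * D.h) * D.s * D.U t + D.U (-t) * D.s * (D.h * D.U t) =
        -(D.U (-t) * (D.h * D.s - D.s * D.h) * D.U t) := by noncomm_ring
    rw [this, D.h_s]
    simp
  have := is_const_of_deriv_eq_zero (fun t => (hd t).differentiableAt) (fun t => (hd t).deriv) t 0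
  simp only [U, Real.exp_zero, neg_zero, zero_smul, NormedSpace.exp_zero, one_smul, one_mul,
    mul_one] at this
  have h1 : D.U t * D.s = Real.exp t • (D.s * D.U t) := by
    conv_lhs => rw [← this]
    change D.U t * (Real.exp t • (D.U (-t) * D.s * D.U t)) = _
    rw [mul_smul_comm, ← mul_assoc, ← mul_assoc, D.U_mul_U_neg, one_mul]
  rw [mul_smul_comm, h1, smul_smul, ← Real.exp_add, neg_add_cancel, Real.exp_zero, one_smul]

theorem semiconj_U_P (t η : ℝ) : D.U t * D.P (Real.exp (-t) * η) = D.P η * D.U t := by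
  have := semiconj_trigSum (show SemiconjBy (D.U t) (Real.exp (-t) • D.s) D.s from D.s_mul_U t)
    D.K η
  rw [trigSum_smul] at this
  exact this

theorem semiconj_U_sec (t η : ℝ) : D.U t * D.sec (Real.exp (-t) * η) = D.sec η * D.U t := by
  have h1 : D.U t * (D.P (Real.exp (-t) * η) * D.P (-(Real.exp (-t) * η))) =
      (D.P η * D.P (-η)) * D.U t := by
    rw [← mul_assoc, D.semiconj_U_P, mul_assoc, ← mul_neg, D.semiconj_U_P, mul_assoc]
  calc D.U t * D.sec (Real.exp (-t) * η)
      = D.sec η * ((D.P η * D.P (-η)) * D.U t) * D.sec (Real.exp (-t) * η) := by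
        rw [← mul_assoc (D.sec η), D.sec_mul, one_mul]
    _ = D.sec η * D.U t := by
        rw [← h1, mul_assoc, mul_assoc, D.mul_sec, mul_one]

theorem semiconj_U_E (t η : ℝ) : D.U t * D.E (Real.exp (-t) * η) = D.E η * D.U t := by
  unfold E
  rw [← mul_assoc, D.semiconj_U_sec, mul_assoc, ← mul_assoc (D.U t), D.semiconj_U_P,
    mul_assoc (D.P η), D.semiconj_U_P]
  simp only [mul_assoc]

end Scaling

/-! ### Holomorphic curves along the Levi foliation. -/

section Leaves

/-- The holomorphic curve `ζ ↦ exp (ζ i s) c`, whose graph sweeps out a leaf of the Levi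
foliation. -/
noncomputable def leaf (c : Cspace m) (ζ : ℂ) : Cspace m :=
  D.P (-ζ.im) (NormedSpace.exp (ζ.re • (mulI m * D.s)) c)

/-- E exchanges P(-η) and P(η), and conjugating ζ changes only the sign of Im ζ. -/
theorem E_leaf (c : Cspace m) (ζ : ℂ) : D.E ζ.im (D.leaf c ζ) = D.leaf c (star ζ) := by
  have := congrArg (fun T : ROp m => T (NormedSpace.exp (ζ.re • (mulI m * D.s)) c))
    (D.E_mul_P_neg ζ.im)
  simpa [leaf] using this

theorem leaf_neg (c : Cspace m) (ζ : ℂ) : D.leaf (-c) ζ = -D.leaf c ζ := by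
  simp [leaf]

theorem leaf_imaginary (c : Cspace m) (η : ℝ) : D.leaf c (η * Complex.I) = D.P (-η) c := by
  simp [leaf, NormedSpace.exp_zero]

theorem differentiable_leaf (c : Cspace m) : Differentiable ℂ (D.leaf c) := by
  intro ζ
  set G : ℝ → ROp m := fun t => NormedSpace.exp (t • (mulI m * D.s)) with hG
  have h1 : HasFDerivAt (fun ζ : ℂ => D.P (-ζ.im))
      (Complex.imCLM.smulRight (-(D.s * D.P ζ.im))) ζ := by
    have := (hasDerivAt_trigSum_neg D.s_pow ζ.im).hasFDerivAt.comp ζ Complex.imCLM.hasFDerivAt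
    refine this.congr_fderiv ?_
    ext v; simp [P]
  have h2 : HasFDerivAt (fun ζ : ℂ => G ζ.re)
      (Complex.reCLM.smulRight ((mulI m * D.s) * G ζ.re)) ζ := by
    have := (hasDerivAt_exp_smul_const' (mulI m * D.s) ζ.re).hasFDerivAt.comp ζ
      Complex.reCLM.hasFDerivAt
    refine this.congr_fderiv ?_
    ext v; simp [hG]
  have h3 := h1.clm_apply (h2.clm_apply (hasFDerivAt_const c ζ))
  have hR : HasFDerivAt (D.leaf c) _ ζ := h3
  rw [differentiableAt_iff_restrictScalars ℝ hR.differentiableAt, hR.fderiv]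
  refine ⟨ContinuousLinearMap.smulRight (1 : ℂ →L[ℂ] ℂ)
    (D.P (-ζ.im) (mulI m (D.s (G ζ.re c)))), ?_⟩
  -- This gives the Cauchy-Riemann equation: the derivative in Im ζ, which is -s P(η) G c, is i
  -- times the derivative in Re ζ.
  have hI : D.P (-ζ.im) (mulI m (D.s (G ζ.re c))) =
      Complex.I • (D.s (D.P ζ.im (G ζ.re c))) := by
    have e1 := congrArg (fun T : ROp m => T (D.s (G ζ.re c))) (D.mulI_mul_P ζ.im)
    have e2 := congrArg (fun T : ROp m => T (G ζ.re c)) (D.commute_s_P ζ.im).eq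
    change mulI m (D.P ζ.im (D.s (G ζ.re c))) = D.P (-ζ.im) (mulI m (D.s (G ζ.re c))) at e1
    change D.s (D.P ζ.im (G ζ.re c)) = D.P ζ.im (D.s (G ζ.re c)) at e2
    rw [← e1, e2, mulI_apply]
  refine ContinuousLinearMap.ext fun v => ?_
  have hv : ∀ x : Cspace m, v • x = v.re • x + v.im • (Complex.I • x) := fun x => by
    rw [real_smul_eq_complex, real_smul_eq_complex, smul_smul, ← add_smul, Complex.re_add_im]
  change v • D.P (-ζ.im) (mulI m (D.s (G ζ.re c))) = _
  rw [hv]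
  simp only [add_apply, ContinuousLinearMap.comp_apply, ContinuousLinearMap.flip_apply,
    ContinuousLinearMap.smulRight_apply, Complex.reCLM_apply, Complex.imCLM_apply, map_smul,
    smul_apply, map_zero, zero_apply, zero_add, neg_apply, mul_apply_eq_comp]
  rw [hI, smul_smul Complex.I, Complex.I_mul_I, neg_one_smul]

theorem contDiff_leaf (c : Cspace m) : ContDiff ℂ ∞ (D.leaf c) := (D.differentiable_leaf c).contDiff

theorem ell_eq_sum (x y : Cspace m) : D.ell x y = ∑ j, x j * D.ell (Pi.single j 1) y := by
  have : x = ∑ j, x j • (Pi.single j 1 : Cspace m) := by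
    ext k; simp [Finset.sum_apply, Pi.single_apply]
  conv_lhs => rw [this]
  rw [map_sum, _root_.sum_apply]
  simp only [D.ell_smul_left]

/-- Antilinearity of `ell` in its second slot cancels the conjugation of ζ, which makes the
correction of w holomorphic. -/
theorem contDiff_ell_leaf_star (x c : Cspace m) :
    ContDiff ℂ ∞ (fun ζ : ℂ => D.ell x (D.leaf c (star ζ))) := by
  have h1 : Differentiable ℂ (fun ζ : ℂ => D.ell (D.leaf c ζ) x) := by
    simp only [D.ell_eq_sum (D.leaf c _) x]
    have := differentiable_pi.1 (D.differentiable_leaf c)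
    fun_prop
  have h2 : (fun ζ : ℂ => D.ell x (D.leaf c (star ζ))) =
      star ∘ (fun ζ => D.ell (D.leaf c ζ) x) ∘ star := funext fun ζ => D.ell_conj _ _
  rw [h2]
  refine Differentiable.contDiff fun ζ => ?_
  simpa using (h1 (star ζ)).star_star

end Leaves

end GradedForm

end CRGeom

/-! ### The model hypersurface and its defining form. -/

namespace CRGeom

section Coordinates

variable {m : ℕ}

/-- The projection `(ζ, w, z) ↦ z`. -/
noncomputable def zproj (m : ℕ) : Cspace (m + 2) →L[ℂ] Cspace m :=
  ContinuousLinearMap.pi fun j => ContinuousLinearMap.proj j.succ.succ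

/-- The point `(ζ, w, z)`. -/
def point (ζ w : ℂ) (z : Cspace m) : Cspace (m + 2) := Fin.cons ζ (Fin.cons w z)

@[simp] theorem point_zero (ζ w : ℂ) (z : Cspace m) : point ζ w z 0 = ζ := rfl

@[simp] theorem point_one (ζ w : ℂ) (z : Cspace m) : point ζ w z 1 = w := rfl

@[simp] theorem zproj_point (ζ w : ℂ) (z : Cspace m) : zproj m (point ζ w z) = z := rfl

theorem point_ext {x y : Cspace (m + 2)} (h0 : x 0 = y 0) (h1 : x 1 = y 1)
    (hz : zproj m x = zproj m y) : x = y := by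
  ext i
  refine Fin.cases h0 (fun i => Fin.cases h1 (fun j => congrFun hz j) i) i

theorem contDiff_point {𝕜 : Type*} [NontriviallyNormedField 𝕜] [NormedSpace 𝕜 ℂ]
    {G : Type*} [NormedAddCommGroup G] [NormedSpace 𝕜 G] {f g : G → ℂ} {k : G → Cspace m}
    (hf : ContDiff 𝕜 ∞ f) (hg : ContDiff 𝕜 ∞ g) (hk : ContDiff 𝕜 ∞ k) :
    ContDiff 𝕜 ∞ (fun x => point (f x) (g x) (k x)) := by
  rw [contDiff_pi]
  intro i
  exact Fin.cases hf (fun i => Fin.cases hg (fun j => contDiff_pi.1 hk j) i) i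

theorem contDiff_zproj : ContDiff ℝ ∞ (zproj m) := (zproj m).contDiff.restrict_scalars ℝ

theorem contDiff_im_zero : ContDiff ℝ ∞ (fun x : Cspace (m + 2) => (x 0).im) :=
  Complex.imCLM.contDiff.comp (contDiff_apply ℝ ℂ 0)

theorem hasFDerivAt_op_apply {T : ℝ → ROp m} {T' : ROp m} {p : Cspace (m + 2)}
    (hT : HasDerivAt T T' (p 0).im) : ∃ L : Cspace (m + 2) →L[ℝ] Cspace m,
      HasFDerivAt (fun x : Cspace (m + 2) => T (x 0).im (zproj m x)) L p ∧
      ∀ v, L v = (v 0).im • T' (zproj m p) + T (p 0).im (zproj m v) := by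
  have h1 : HasFDerivAt (fun x : Cspace (m + 2) => (x 0).im)
      (Complex.imCLM.comp (ContinuousLinearMap.proj 0)) p :=
    Complex.imCLM.hasFDerivAt.comp p (hasFDerivAt_apply 0 p)
  have h2 := hT.hasFDerivAt.comp p h1
  have h3 : HasFDerivAt (zproj m) ((zproj m).restrictScalars ℝ) p :=
    ((zproj m).restrictScalars ℝ).hasFDerivAt
  refine ⟨_, h2.clm_apply h3, fun v => ?_⟩
  simp [add_comm]

end Coordinates

namespace GradedForm

variable {m : ℕ} (D : GradedForm m)

section Forms

/-- `Re ell (E(Im ζ) z, z)` at the point `(ζ, w, z)`. -/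
noncomputable def potential (x : Cspace (m + 2)) : ℝ :=
  (D.ell (D.E (x 0).im (zproj m x)) (zproj m x)).re

/-- The derivative of the potential in the direction of `Im ζ`. -/
noncomputable def potentialDeriv (x : Cspace (m + 2)) : ℝ :=
  (D.ell (D.Ederiv (x 0).im (zproj m x)) (zproj m x)).re

/-- The homogeneous hypersurface `Re w = Re ell (E(Im ζ) z, z)`, `Im ζ > 0`. -/
def model : Set (Cspace (m + 2)) := {x | 0 < (x 0).im ∧ (x 1).re = D.potential x}

/-- The complex-linear form `x ↦ ell x y`. -/
noncomputable def ellLeft (y : Cspace m) : Cspace m →L[ℂ] ℂ :=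
  ∑ j, D.ell (Pi.single j 1) y • ContinuousLinearMap.proj j

theorem ellLeft_apply (x y : Cspace m) : D.ellLeft y x = D.ell x y := by
  rw [D.ell_eq_sum x y, ellLeft, _root_.sum_apply]
  exact Finset.sum_congr rfl fun j _ => mul_comm _ _

/-- The `(1,0)`-form whose real part is the differential of the defining function. -/
noncomputable def form (x : Cspace (m + 2)) : Cspace (m + 2) →L[ℂ] ℂ :=
  ContinuousLinearMap.proj 1 -
    (2 : ℂ) • (D.ellLeft (D.E (x 0).im (zproj m x))).comp (zproj m) +
    (Complex.I * D.potentialDeriv x) • ContinuousLinearMap.proj 0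

theorem form_apply (x a : Cspace (m + 2)) : D.form x a =
    a 1 - 2 * D.ell (zproj m a) (D.E (x 0).im (zproj m x)) +
      Complex.I * D.potentialDeriv x * a 0 := by
  simp [form, ellLeft_apply]

theorem contDiff_op_apply {T : ℝ → ROp m} (hT : ContDiff ℝ ∞ T) :
    ContDiff ℝ ∞ (fun x : Cspace (m + 2) => T (x 0).im (zproj m x)) :=
  (hT.comp contDiff_im_zero).clm_apply contDiff_zproj

theorem contDiff_quadratic {T : ℝ → ROp m} (hT : ContDiff ℝ ∞ T) :
    ContDiff ℝ ∞ (fun x : Cspace (m + 2) => (D.ell (T (x 0).im (zproj m x)) (zproj m x)).re) :=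
  Complex.reCLM.contDiff.comp
    ((D.ell.contDiff.comp (contDiff_op_apply hT)).clm_apply contDiff_zproj)

theorem contDiff_potential : ContDiff ℝ ∞ D.potential := D.contDiff_quadratic D.contDiff_E

theorem contDiff_potentialDeriv : ContDiff ℝ ∞ D.potentialDeriv := D.contDiff_quadratic D.contDiff_Ederiv

theorem contDiff_form : ContDiff ℝ ∞ D.form := by
  have h1 : ContDiff ℝ ∞ (fun x : Cspace (m + 2) => D.E (x 0).im (zproj m x)) :=
    contDiff_op_apply D.contDiff_E
  have h2 : ContDiff ℝ ∞ D.ellLeft := by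
    unfold ellLeft
    exact ContDiff.sum fun j _ => (D.ell (Pi.single j 1)).contDiff.smul contDiff_const
  have h3 : ContDiff ℝ ∞ (fun x => (D.potentialDeriv x : ℂ)) :=
    Complex.ofRealCLM.contDiff.comp D.contDiff_potentialDeriv
  have h4 : ContDiff ℝ ∞ (fun L : Cspace m →L[ℂ] ℂ => L.comp (zproj m)) :=
    (((ContinuousLinearMap.compL ℂ (Cspace (m + 2)) (Cspace m) ℂ).flip
      (zproj m)).contDiff).restrict_scalars ℝ
  have h5 : ContDiff ℝ ∞ (fun x : Cspace (m + 2) =>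
      (2 : ℂ) • (D.ellLeft (D.E (x 0).im (zproj m x))).comp (zproj m)) :=
    (h4.comp (h2.comp h1)).const_smul (2 : ℂ)
  have h6 : ContDiff ℝ ∞ (fun x => Complex.I * (D.potentialDeriv x : ℂ)) := contDiff_const.mul h3
  have h7 : ContDiff ℝ ∞ (fun x => (Complex.I * (D.potentialDeriv x : ℂ)) •
      (ContinuousLinearMap.proj 0 : Cspace (m + 2) →L[ℂ] ℂ)) := h6.smul contDiff_const
  exact (contDiff_const.sub h5).add h7

/-- Self-adjointness merges the two z-derivatives into one term with factor 2. -/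
theorem hasFDerivAt_quadratic {T : ℝ → ROp m} {T' : ROp m} {p : Cspace (m + 2)}
    (hT : HasDerivAt T T' (p 0).im) (hsa : D.IsSelfAdj (T (p 0).im)) :
    ∃ L : Cspace (m + 2) →L[ℝ] ℝ,
      HasFDerivAt
        (fun x : Cspace (m + 2) => (D.ell (T (x 0).im (zproj m x)) (zproj m x)).re) L p ∧
      ∀ v, L v = (v 0).im * (D.ell (T' (zproj m p)) (zproj m p)).re +
        2 * (D.ell (zproj m v) (T (p 0).im (zproj m p))).re := by
  obtain ⟨L, hL, hLv⟩ := hasFDerivAt_op_apply hT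
  have h3 : HasFDerivAt (zproj m) ((zproj m).restrictScalars ℝ) p :=
    ((zproj m).restrictScalars ℝ).hasFDerivAt
  refine ⟨_, Complex.reCLM.hasFDerivAt.comp p
    ((D.ell.hasFDerivAt.comp p hL).clm_apply h3), fun v => ?_⟩
  simp only [ContinuousLinearMap.comp_apply, add_apply, ContinuousLinearMap.flip_apply, hLv,
    map_add, map_smul, smul_apply, Complex.reCLM_apply, Complex.real_smul,
    Complex.re_ofReal_mul, ContinuousLinearMap.coe_restrictScalars', Function.comp_apply]
  rw [hsa (zproj m v) (zproj m p), D.ell_re_comm (T (p 0).im (zproj m p))]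
  ring

/-- The potential does not involve w, so subtracting the defining function from w lands on the
model. -/
theorem isDefinedBy : IsDefinedBy D.model {x | 0 < (x 0).im}
    (fun x => (x 1).re - D.potential x) D.form (point 0 1 0) where
  isOpen := isOpen_lt continuous_const (contDiff_im_zero (m := m)).continuous
  eq := by
    ext x
    simp only [model, Set.mem_ofPred_eq, sub_eq_zero]
  smooth := ((Complex.reCLM.contDiff.comp (contDiff_apply ℝ ℂ 1)).sub
    D.contDiff_potential).contDiffOn
  smooth_form := D.contDiff_form.contDiffOn
  fderiv_eq := fun x _ v => by
    obtain ⟨L, hL, hLv⟩ := D.hasFDerivAt_quadratic (D.hasDerivAt_E (x 0).im) (D.isSelfAdj_E _)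
    have h1 : HasFDerivAt (fun x : Cspace (m + 2) => (x 1).re)
        (Complex.reCLM.comp (ContinuousLinearMap.proj 1)) x :=
      Complex.reCLM.hasFDerivAt.comp x (hasFDerivAt_apply 1 x)
    have h2 : HasFDerivAt (fun x : Cspace (m + 2) => (x 1).re - D.potential x) _ x := h1.sub hL
    rw [h2.fderiv, sub_apply, hLv, form_apply]
    simp [potentialDeriv]
    ring
  form_normal := fun x _ => by simp [form_apply]
  retract := fun x hx => by
    have h0 : (x - ((x 1).re - D.potential x) • point 0 1 0 : Cspace (m + 2)) 0 = x 0 := by simp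
    have h1 : (x - ((x 1).re - D.potential x) • point 0 1 0 : Cspace (m + 2)) 1 =
        x 1 - ((x 1).re - D.potential x : ℝ) := by simp
    have hz : zproj m (x - ((x 1).re - D.potential x) • point 0 1 0) = zproj m x := by
      rw [map_sub, real_smul_eq_complex, map_smul]; simp
    refine ⟨by rw [h0]; exact hx, ?_⟩
    change (_ : ℂ).re = (D.ell (D.E (_ : ℂ).im _) _).re
    rw [h0, h1, hz]
    simp [potential]

end Forms

/-! ### The Levi form as a completed square. -/

section Levi

/-- The `z`-component of the leaf direction at the point `(ζ, w, z)`. -/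
noncomputable def leafDir (x : Cspace (m + 2)) : Cspace m :=
  Complex.I • D.s (D.E (x 0).im (zproj m x))

theorem Ederiv_apply (η : ℝ) (z : Cspace m) : D.Ederiv η z = (2 : ℝ) • D.s (D.sec η (D.E η z)) := by
  rw [D.Ederiv_eq]; rfl

/-- The mixed z-ζ terms of the Levi form involve E' z; since E' = 2 s sec E, they are sec applied to
the leaf direction. -/
theorem sec_leafDir (x : Cspace (m + 2)) :
    (2 : ℂ) • D.sec (x 0).im (D.leafDir x) = Complex.I • D.Ederiv (x 0).im (zproj m x) := by
  have h := congrArg (fun T : ROp m => T (D.E (x 0).im (zproj m x))) (D.commute_s_sec (x 0).im).eq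
  change D.s (D.sec _ _) = D.sec _ (D.s _) at h
  rw [leafDir, D.sec_apply_smul, Ederiv_apply, ← h, real_smul_eq_complex]
  push_cast
  module

/-- The second ζ-derivative of the potential is exactly the term that completes the square. This
equality is what makes the Levi form degenerate. -/
theorem Ederiv2_quadratic (x : Cspace (m + 2)) :
    ((D.ell (D.Ederiv2 (x 0).im (zproj m x)) (zproj m x)).re : ℂ) =
      4 * D.ell (D.leafDir x) (D.sec (x 0).im (D.leafDir x)) := by
  set η := (x 0).im
  set z := zproj m x
  have hre : D.ell (D.leafDir x) (D.sec η (D.leafDir x)) =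
      ((D.ell (D.leafDir x) (D.sec η (D.leafDir x))).re : ℂ) := by
    apply Complex.ext
    · simp
    · have h1 := (D.isSelfAdj_sec η).ell_apply_of_commute (D.commute_mulI_sec η)
        (D.leafDir x) (D.leafDir x)
      have h2 := congrArg Complex.im (D.ell_conj (D.sec η (D.leafDir x)) (D.leafDir x))
      rw [h1] at h2
      simp at h2 ⊢
      linarith
  rw [hre]
  have h3 : D.ell (D.leafDir x) (D.sec η (D.leafDir x)) =
      D.ell (D.s (D.E η z)) (D.sec η (D.s (D.E η z))) := by
    rw [leafDir, D.sec_apply_smul, D.ell_smul_left, D.ell_smul_right, ← mul_assoc]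
    simp [η, z]
  have h4 : D.Ederiv2 η = (4 : ℝ) • (D.E η * (D.s * (D.sec η * (D.s * D.E η)))) := by
    rw [Ederiv2]
    congr 1
    have hs := (D.commute_s_sec η).eq
    have hE := (D.commute_s_E η).eq
    have hsE := (D.commute_sec_E η).eq
    calc D.s * D.s * (D.sec η * (D.E η * D.E η))
        = D.s * D.s * (D.E η * (D.sec η * D.E η)) := by
          conv_lhs => rw [← mul_assoc (D.sec η), hsE, mul_assoc (D.E η)]
      _ = D.E η * (D.s * (D.s * (D.sec η * D.E η))) := by
          rw [mul_assoc, ← mul_assoc D.s (D.E η), hE, mul_assoc, ← mul_assoc D.s (D.E η), hE,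
            mul_assoc]
      _ = _ := by rw [← mul_assoc D.s (D.sec η), hs, mul_assoc]
  have h5 : (D.ell (D.Ederiv2 η z) z).re =
      4 * (D.ell (D.E η (D.s (D.sec η (D.s (D.E η z))))) z).re := by
    rw [h4]
    change (D.ell ((4 : ℝ) • D.E η (D.s (D.sec η (D.s (D.E η z))))) z).re = _
    rw [map_smul, smul_apply, Complex.real_smul, Complex.re_ofReal_mul]
  rw [h5, D.isSelfAdj_E, D.isSelfAdj_s, D.isSelfAdj_sec, h3]
  push_cast
  rfl

/-- The Levi form of the model. -/
theorem cderiv_form {p : Cspace (m + 2)} (a b : Cspace (m + 2)) :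
    cderiv D.form p (0, star b) a = -2 * D.ell (zproj m a - a 0 • D.leafDir p)
      (D.sec (p 0).im (zproj m b - b 0 • D.leafDir p)) := by
  have hΘ : DifferentiableAt ℝ D.form p := D.contDiff_form.contDiffAt.differentiableAt (by simp)
  have h1 := cderiv_clm_apply hΘ (differentiableAt_const a) (0, star b)
  have h2 : cderiv (fun _ : Cspace (m + 2) => a) p (0, star b) = 0 := by
    rw [cderiv_inr, (hasFDerivAt_const a p).fderiv]; simp
  rw [h2, map_zero, add_zero] at h1
  rw [← h1]
  obtain ⟨L, hL, hLv⟩ := hasFDerivAt_op_apply (D.hasDerivAt_E (p 0).im)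
  obtain ⟨R, hR, hRv⟩ := D.hasFDerivAt_quadratic (D.hasDerivAt_Ederiv (p 0).im) (D.isSelfAdj_Ederiv _)
  have hg : HasFDerivAt (fun x => D.form x a)
      (-(2 : ℂ) • (D.ell (zproj m a)).comp L +
        (Complex.I * a 0) • Complex.ofRealCLM.comp R) p := by
    have e1 : HasFDerivAt (fun x : Cspace (m + 2) =>
        D.ell (zproj m a) (D.E (x 0).im (zproj m x))) ((D.ell (zproj m a)).comp L) p :=
      (D.ell (zproj m a)).hasFDerivAt.comp p hL
    have e2 : HasFDerivAt (fun x => (D.potentialDeriv x : ℂ)) (Complex.ofRealCLM.comp R) p :=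
      Complex.ofRealCLM.hasFDerivAt.comp p hR
    have e3 := (((e1.const_smul (-(2 : ℂ))).add (e2.const_smul (Complex.I * a 0))).const_add (a 1))
    refine e3.congr_of_eventuallyEq (Filter.Eventually.of_forall fun x => ?_)
    simp only [form_apply, Pi.add_apply, Pi.smul_apply, smul_eq_mul]
    ring
  rw [cderiv_inr, hg.fderiv, star_star]
  set η := (p 0).im
  set z := zproj m p
  have hIE := D.E_apply_I η (zproj m b)
  simp only [add_apply, smul_apply, ContinuousLinearMap.comp_apply, hLv, hRv,
    Complex.ofRealCLM_apply, map_smul, hIE, Pi.smul_apply, smul_eq_mul]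
  have hv := D.sec_leafDir p
  have hsec : D.ell (zproj m a) (D.sec η (D.leafDir p)) =
      -(Complex.I / 2) * D.ell (zproj m a) (D.Ederiv η z) := by
    have := congrArg (D.ell (zproj m a)) hv
    rw [D.ell_smul_right, D.ell_smul_right] at this
    simp at this
    linear_combination this / 2
  have hsec2 : D.ell (D.leafDir p) (D.sec η (zproj m b)) =
      (Complex.I / 2) * D.ell (D.Ederiv η z) (zproj m b) := by
    rw [← (D.isSelfAdj_sec η).ell_apply_of_commute (D.commute_mulI_sec η)]
    have := congrArg (fun y => D.ell y (zproj m b)) hv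
    simp only [D.ell_smul_left] at this
    linear_combination this / 2
  have hq := D.Ederiv2_quadratic p
  have hsub : D.ell (zproj m a - a 0 • D.leafDir p)
      (D.sec η (zproj m b - b 0 • D.leafDir p)) =
      D.ell (zproj m a) (D.sec η (zproj m b)) -
        star (b 0) * D.ell (zproj m a) (D.sec η (D.leafDir p)) -
        a 0 * (D.ell (D.leafDir p) (D.sec η (zproj m b)) -
          star (b 0) * D.ell (D.leafDir p) (D.sec η (D.leafDir p))) := by
    rw [map_sub, map_sub, sub_apply, map_sub, map_sub, D.sec_apply_smul, D.ell_smul_right,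
      D.ell_smul_left, D.ell_smul_left, D.ell_smul_right]
    ring
  rw [hsub, hsec, hsec2]
  have hconj : D.ell (D.Ederiv η z) (zproj m b) =
      ((D.ell (zproj m b) (D.Ederiv η z)).re : ℂ) -
        Complex.I * (D.ell (zproj m b) (D.Ederiv η z)).im := by
    rw [D.ell_conj (zproj m b)]
    apply Complex.ext <;> simp
  have hmul : (Complex.I * D.ell (zproj m b) (D.Ederiv η z)).re =
      -(D.ell (zproj m b) (D.Ederiv η z)).im := by simp
  have hb0 : star (b 0) = ((b 0).re : ℂ) - Complex.I * (b 0).im := by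
    apply Complex.ext <;> simp
  have hI2 : (Complex.I * b 0).im = (b 0).re := by simp
  rw [hconj, hb0]
  simp only [D.ell_smul_left, hmul, hI2, map_add, map_smul, map_sub, map_nsmul,
    D.ell_smul_right, Complex.real_smul]
  push_cast
  have hq' : D.ell (D.leafDir p) (D.sec η (D.leafDir p)) =
      ((D.ell (D.Ederiv2 η z) z).re : ℂ) / 4 := by
    rw [hq]; ring
  rw [hq']
  have hI : Complex.I ^ 2 = -1 := Complex.I_sq
  simp only [Complex.star_def, Complex.conj_I, nsmul_eq_mul]
  push_cast
  linear_combination (2 * D.ell (zproj m a) (D.sec η (zproj m b)) -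
    D.ell (zproj m a) (D.E η (zproj m b)) +
    a 0 * (b 0).re * ((D.ell (D.Ederiv2 η z) z).re : ℂ) / 2 -
    (b 0).im * D.ell (zproj m a) (D.Ederiv η z)) * hI

end Levi

end GradedForm

end CRGeom

namespace CRGeom

namespace GradedForm

variable {m : ℕ} (D : GradedForm m)

/-! ### The Levi kernel and its sections. -/

section Kernel

/-- The CR vector at `x` with prescribed `ζ`- and `z`-components. -/
noncomputable def lift (x : Cspace (m + 2)) (α : ℂ) (y : Cspace m) : Cspace (m + 2) :=
  point α (2 * D.ell y (D.E (x 0).im (zproj m x)) - Complex.I * D.potentialDeriv x * α) y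

theorem form_lift (x : Cspace (m + 2)) (α : ℂ) (y : Cspace m) : D.form x (D.lift x α y) = 0 := by
  rw [form_apply]
  simp only [lift, point_zero, point_one, zproj_point]
  ring

theorem eq_lift {x a : Cspace (m + 2)} (h : D.form x a = 0) :
    a = D.lift x (a 0) (zproj m a) := by
  refine point_ext rfl ?_ rfl
  rw [form_apply] at h
  simp only [lift, point_one]
  linear_combination h

theorem lift_smul (x : Cspace (m + 2)) (c α : ℂ) (y : Cspace m) :
    D.lift x (c * α) (c • y) = c • D.lift x α y := by
  refine point_ext rfl ?_ rfl
  simp only [lift, point_one, Pi.smul_apply, smul_eq_mul, D.ell_smul_left]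
  ring

theorem contDiff_lift {f : Cspace (m + 2) → ℂ} {g : Cspace (m + 2) → Cspace m}
    (hf : ContDiff ℝ ∞ f) (hg : ContDiff ℝ ∞ g) :
    ContDiff ℝ ∞ (fun x => D.lift x (f x) (g x)) := by
  refine contDiff_point hf ?_ hg
  have h1 : ContDiff ℝ ∞ (fun x : Cspace (m + 2) =>
      D.ell (g x) (D.E (x 0).im (zproj m x))) :=
    (D.ell.contDiff.comp hg).clm_apply (contDiff_op_apply D.contDiff_E)
  have h3 : ContDiff ℝ ∞ (fun x => (D.potentialDeriv x : ℂ)) :=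
    Complex.ofRealCLM.contDiff.comp D.contDiff_potentialDeriv
  exact (contDiff_const.mul h1).sub ((contDiff_const.mul h3).mul hf)

theorem isSectionNear_lift {f : Cspace (m + 2) → ℂ} {g : Cspace (m + 2) → Cspace m}
    (hf : ContDiff ℝ ∞ f) (hg : ContDiff ℝ ∞ g) (p : Cspace (m + 2)) :
    IsSectionNear D.model (crSpace D.model) p (fun x => D.lift x (f x) (g x)) :=
  ⟨Set.univ, isOpen_univ, trivial, (D.contDiff_lift hf hg).contDiffOn,
    fun x hx => (D.isDefinedBy.mem_crSpace hx.1).2 (D.form_lift x _ _)⟩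

theorem contDiff_leafDir : ContDiff ℝ ∞ D.leafDir :=
  (D.s.contDiff.comp (contDiff_op_apply D.contDiff_E)).const_smul Complex.I

theorem leviKernel_eq {p : Cspace (m + 2)} (hp : p ∈ D.model) :
    leviKernel D.model p = Submodule.span ℂ {D.lift p 1 (D.leafDir p)} := by
  have hD := D.isDefinedBy
  apply le_antisymm
  · refine Submodule.span_le.2 ?_
    rintro v ⟨hv, hbr⟩
    have hvl := D.eq_lift ((hD.mem_crSpace hp).1 hv)
    have hz : zproj m v - v 0 • D.leafDir p = 0 := by
      apply D.nondeg
      intro y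
      -- The test section has z-component cos(2ηs) y, which cancels the sec in the Levi form and
      -- leaves `ell` paired with an arbitrary y.
      have h1 := (hD.bracket_mem_iff hp
        (D.isSectionNear_lift contDiff_const contDiff_const p)
        (D.isSectionNear_lift contDiff_const contDiff_const p)).1
        (hbr (fun x => D.lift x (v 0) (zproj m v))
          (fun x => D.lift x 0 ((D.P (p 0).im * D.P (-(p 0).im)) y))
          (D.isSectionNear_lift contDiff_const contDiff_const p)
          (D.isSectionNear_lift contDiff_const contDiff_const p) hvl.symm)
      have h2 := h1.1
      rw [D.cderiv_form] at h2
      have h3 : D.sec (p 0).im (D.P (p 0).im (D.P (-(p 0).im) y)) = y :=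
        congrArg (fun T : ROp m => T y) (D.sec_mul (p 0).im)
      simpa [lift, h3] using h2
    rw [sub_eq_zero] at hz
    refine Submodule.mem_span_singleton.2 ⟨v 0, ?_⟩
    rw [← D.lift_smul, mul_one, ← hz]
    exact hvl.symm
  · rw [Submodule.span_singleton_le_iff_mem]
    refine Submodule.subset_span ⟨(hD.mem_crSpace hp).2 (D.form_lift p _ _), ?_⟩
    intro V W hV hW hVp
    rw [hD.bracket_mem_iff hp hV hW, hVp, D.cderiv_form, D.cderiv_form]
    simp [lift]

theorem isSectionNear_kernel (κ : ℂ) (p : Cspace (m + 2)) :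
    IsSectionNear D.model (leviKernel D.model) p
      (fun x => D.lift x κ (κ • D.leafDir x)) := by
  refine ⟨Set.univ, isOpen_univ, trivial,
    (D.contDiff_lift contDiff_const (D.contDiff_leafDir.const_smul κ)).contDiffOn,
    fun x hx => ?_⟩
  change D.lift x κ (κ • D.leafDir x) ∈ leviKernel D.model x
  rw [D.leviKernel_eq hx.1]
  have := D.lift_smul x κ 1 (D.leafDir x)
  rw [mul_one] at this
  exact Submodule.mem_span_singleton.2 ⟨κ, this.symm⟩

theorem zproj_cderiv {X : Cspace (m + 2) → Cspace (m + 2)} {p : Cspace (m + 2)}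
    (hX : DifferentiableAt ℝ X p) (Z : CVec (m + 2)) :
    zproj m (cderiv X p Z) = cderiv (fun x => zproj m (X x)) p Z := by
  have h : HasFDerivAt (fun x => zproj m (X x))
      (((zproj m).restrictScalars ℝ).comp (fderiv ℝ X p)) p :=
    ((zproj m).restrictScalars ℝ).hasFDerivAt.comp p hX.hasFDerivAt
  unfold cderiv
  rw [h.fderiv, complexify_apply, complexify_apply, map_add, map_smul (zproj m)]
  rfl

theorem cderiv_apply_zero {X : Cspace (m + 2) → Cspace (m + 2)} {p : Cspace (m + 2)}
    (hX : DifferentiableAt ℝ X p) (Z : CVec (m + 2)) :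
    cderiv X p Z 0 = cderiv (fun x => X x 0) p Z := by
  have h : HasFDerivAt (fun x => X x 0)
      ((ContinuousLinearMap.proj 0 : Cspace (m + 2) →L[ℝ] ℂ).comp (fderiv ℝ X p)) p :=
    (ContinuousLinearMap.proj 0 : Cspace (m + 2) →L[ℝ] ℂ).hasFDerivAt.comp p hX.hasFDerivAt
  unfold cderiv
  rw [h.fderiv, complexify_apply, complexify_apply]
  rfl

/-- A (0,1)-derivative along z sees only the antilinear dependence on z. As `s` is antilinear, this
selects the linear part of E, namely sec. -/
theorem cderiv_leafDir (κ : ℂ) (p b : Cspace (m + 2)) (hb : b 0 = 0) :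
    cderiv (fun x => κ • D.leafDir x) p (0, star b) =
      (κ * Complex.I) • D.s (D.sec (p 0).im (zproj m b)) := by
  obtain ⟨L, hL, hLv⟩ := hasFDerivAt_op_apply (D.hasDerivAt_E (p 0).im)
  have h1 : HasFDerivAt (fun x => κ • D.leafDir x) (κ • Complex.I • D.s.comp L) p :=
    ((D.s.hasFDerivAt.comp p hL).const_smul Complex.I).const_smul κ
  rw [cderiv_inr, h1.fderiv, star_star]
  simp only [smul_apply, ContinuousLinearMap.comp_apply, hLv, map_smul, Pi.smul_apply, hb,
    smul_zero, Complex.zero_im, zero_smul, zero_add, D.E_apply_I, D.s_apply_smul, map_sub,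
    map_nsmul]
  simp only [smul_smul, smul_sub, Complex.star_def, Complex.conj_I]
  match_scalars
  · linear_combination (κ * Complex.I / 2) * Complex.I_sq
  · linear_combination (-κ * Complex.I) * Complex.I_sq

end Kernel

/-! ### The CR symbol of the model. -/

section Symbol

/-- The symbol of the model at a point, in terms of the data at `Im ζ = 1 / 2`. -/
theorem hasCRSymbol {H A : Matrix (Fin m) (Fin m) ℂ}
    (hH : ∀ j k, D.ell (Pi.single j 1) (D.sec (1 / 2) (Pi.single k 1)) = H j k)
    (hA : ∀ k, D.s (D.sec (1 / 2) (Pi.single k 1)) = fun j => A j k)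
    {p : Cspace (m + 2)} (hp : p ∈ D.model) : HasCRSymbol D.model p H A := by
  have hD := D.isDefinedBy
  have hη : 0 < (p 0).im := hp.1
  set η := (p 0).im with hη_def
  -- Chosen so that e^(-t) η = 1/2: then `U t` transports the data at Im ζ = 1/2 to height η.
  set t := Real.log (2 * η) with ht
  have hexp : Real.exp t = 2 * η := Real.exp_log (by linarith)
  have hhalf : Real.exp (-t) * η = 1 / 2 := by
    rw [Real.exp_neg, hexp]; field_simp
  set u : Fin m → Cspace m := fun j => D.U t (Pi.single j 1) with hu
  have hUsmul : ∀ (c : ℂ) x, D.U t (c • x) = c • D.U t x :=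
    map_complex_smul_of_commute (D.commute_mulI_U t)
  have hsecu : ∀ k, D.sec η (u k) = D.U t (D.sec (1 / 2) (Pi.single k 1)) := fun k => by
    have := congrArg (fun T : ROp m => T (Pi.single k 1)) (D.semiconj_U_sec t η)
    rw [hhalf] at this
    exact this.symm
  have hell : ∀ j k, D.ell (u j) (D.sec η (u k)) = H j k := fun j k => by
    rw [hsecu, D.ell_U, hH]
  have hA' : ∀ k, ∑ j, A j k • u j = D.U t (fun j => A j k) := fun k => by
    conv_rhs => rw [show (fun j => A j k) = ∑ j, A j k • (Pi.single j 1 : Cspace m) by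
      ext i; simp [Finset.sum_apply, Pi.single_apply]]
    rw [map_sum]
    simp only [hUsmul, hu]
  have had : ∀ k, (Real.exp t : ℂ) • D.s (D.sec η (u k)) = ∑ j, A j k • u j := fun k => by
    rw [hsecu, hA', ← hA]
    have := congrArg (fun T : ROp m => T (D.sec (1 / 2) (Pi.single k 1))) (D.s_mul_U t)
    change D.U t (Real.exp (-t) • D.s _) = D.s (D.U t _) at this
    rw [← this, map_smul, ← real_smul_eq_complex, smul_smul, ← Real.exp_add, add_neg_cancel,
      Real.exp_zero, one_smul]
  -- The bracket produces the factor -κ i, which equals e^t and undoes the scaling of `s` by `U t`.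
  set κ : ℂ := Complex.I * Real.exp t with hκ
  have hκ0 : κ ≠ 0 := mul_ne_zero Complex.I_ne_zero
    (Complex.ofReal_ne_zero.2 (Real.exp_pos t).ne')
  set X : Fin m → Cspace (m + 2) → Cspace (m + 2) := fun j x => D.lift x 0 (u j) with hX
  set V : Cspace (m + 2) → Cspace (m + 2) := fun x => D.lift x κ (κ • D.leafDir x) with hV
  have hXs : ∀ j, IsSectionNear D.model (crSpace D.model) p (X j) := fun j =>
    D.isSectionNear_lift contDiff_const contDiff_const p
  have hVs : IsSectionNear D.model (leviKernel D.model) p V := D.isSectionNear_kernel κ p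
  have hVcr : IsSectionNear D.model (crSpace D.model) p V :=
    D.isSectionNear_lift contDiff_const (D.contDiff_leafDir.const_smul κ) p
  have hVp : V p = κ • D.lift p 1 (D.leafDir p) := by
    rw [← D.lift_smul, mul_one]
  have hVspan : Submodule.span ℂ {V p} = leviKernel D.model p := by
    rw [D.leviKernel_eq hp, hVp, Submodule.span_singleton_smul_eq hκ0.isUnit]
  have hsumX : ∀ c : Fin m → ℂ, ∑ j, c j • X j p = D.lift p 0 (∑ j, c j • u j) := fun c => by
    refine point_ext (by simp [hX, lift, Finset.sum_apply]) ?_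
      (by simp [hX, lift, map_sum])
    simp only [hX, lift, Finset.sum_apply, Pi.smul_apply, point_one, smul_eq_mul, mul_zero,
      sub_zero, map_sum, _root_.sum_apply, D.ell_smul_left, Finset.mul_sum]
    exact Finset.sum_congr rfl fun j _ => by ring
  have hUinv : ∀ x, D.U (-t) (D.U t x) = x := fun x => by
    have := D.U_mul_U_neg (-t)
    rw [neg_neg] at this
    exact congrArg (fun T : ROp m => T x) this
  have hsumu : ∀ c : Fin m → ℂ, ∑ j, c j • u j = D.U t c := fun c => by
    conv_rhs => rw [show c = ∑ j, c j • (Pi.single j 1 : Cspace m) by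
      ext i; simp [Finset.sum_apply, Pi.single_apply]]
    rw [map_sum]
    simp only [hUsmul, hu]
  -- The real vector is i ∂/∂w plus its conjugate. The form takes the value i on it, so 2i H is
  -- matched with the value -2 H of `cderiv_form`.
  refine ⟨X, V, point 0 Complex.I 0, hXs, hVs, ?_, ?_, hVspan, ?_, ?_, ?_, ?_⟩
  · rw [Fintype.linearIndependent_iff]
    intro c hc
    rw [Fin.sum_univ_succ] at hc
    simp only [Fin.cons_zero, Fin.cons_succ] at hc
    rw [hsumX (fun j => c j.succ)] at hc
    have h0 : c 0 = 0 := by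
      have := congrFun hc 0
      simpa [hV, lift, hκ0] using this
    have hz := congrArg (zproj m) hc
    rw [h0, hsumu] at hz
    have hz' : D.U t (fun j => c j.succ) = 0 := by simpa [lift] using hz
    have := hUinv (fun j => c j.succ)
    rw [hz', map_zero] at this
    exact Fin.cases h0 fun j => (congrFun this j).symm
  · apply le_antisymm
    · rw [Submodule.span_le]
      rintro _ ⟨i, rfl⟩
      exact Fin.cases (hVcr.mem hp) (fun j => (hXs j).mem hp) i
    · intro a ha
      have hal := D.eq_lift ((hD.mem_crSpace hp).1 ha)
      set y := zproj m a - (a 0) • D.leafDir p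
      have hy : ∑ j, (D.U (-t) y) j • u j = y := by
        rw [hsumu]
        exact congrArg (fun T : ROp m => T y) (D.U_mul_U_neg t)
      have hdec : a = (a 0 * κ⁻¹) • V p + ∑ j, (D.U (-t) y) j • X j p := by
        rw [hsumX, hy, hVp, smul_smul, mul_assoc, inv_mul_cancel₀ hκ0, mul_one]
        refine point_ext (by simp [lift]) ?_ (by simp [lift, y])
        conv_lhs => rw [hal]
        simp only [lift, y, Pi.add_apply, Pi.smul_apply, point_one, smul_eq_mul, map_sub,
          sub_apply, D.ell_smul_left]
        ring
      rw [hdec]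
      refine Submodule.add_mem _ (Submodule.smul_mem _ _ (Submodule.subset_span ⟨0, rfl⟩))
        (Submodule.sum_mem _ fun j _ => Submodule.smul_mem _ _
          (Submodule.subset_span ⟨j.succ, rfl⟩))
  · rw [hD.mem_ctangent hp]
    simp [form_apply]
  · intro h
    have := (hD.mem_crSpace hp).1 (Submodule.mem_prod.1 h).1
    simp [form_apply] at this
  · intro j k
    rw [hD.bracket_sub_mem_iff hp (hXs j) (hXs k), D.cderiv_form, D.cderiv_form]
    have h1 : H k j = star (H j k) := by
      rw [← hell k j, ← (D.isSelfAdj_sec η).ell_apply_of_commute (D.commute_mulI_sec η), D.ell_conj, hell]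
    simp only [hX, lift, zproj_point, point_zero, zero_smul, sub_zero, ← hη_def, hell,
      form_apply, Prod.smul_fst, Prod.smul_snd, map_smul, star_smul, star_star]
    simp only [point_one, map_zero, mul_zero, smul_eq_mul, zero_apply]
    constructor
    · linear_combination (-2 * H j k) * Complex.I_sq
    · rw [h1]
      simp only [Complex.star_def, map_mul, Complex.conj_I, Complex.conj_ofNat]
      linear_combination (-2 * starRingEnd ℂ (H j k)) * Complex.I_sq
  · intro k
    have hVd := hVs.differentiableAt
    have hmem := (hD.bracket_mem_iff hp hVcr (hXs k)).2 (by
      rw [D.cderiv_form, D.cderiv_form]; simp [hV, lift])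
    rw [bracket_hol_conj hVd (hXs k).differentiableAt, Submodule.mem_prod] at hmem ⊢
    refine ⟨?_, by simpa using hmem.2⟩
    -- Equality is exact, not only modulo K: a CR vector is determined by its ζ- and z-components,
    -- and both vanish here.
    have hzero : -cderiv V p (0, star (X k p)) - ∑ j, A j k • X j p = 0 := by
      have hcr : D.form p (-cderiv V p (0, star (X k p)) - ∑ j, A j k • X j p) = 0 := by
        rw [map_sub, (hD.mem_crSpace hp).1 hmem.1, hsumX, D.form_lift, sub_zero]
      rw [D.eq_lift hcr]
      have hc0 : (-cderiv V p (0, star (X k p)) - ∑ j, A j k • X j p) 0 = 0 := by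
        rw [hsumX, Pi.sub_apply, Pi.neg_apply, cderiv_apply_zero hVd]
        simp [hV, lift, cderiv_inr]
      have hcz : zproj m (-cderiv V p (0, star (X k p)) - ∑ j, A j k • X j p) = 0 := by
        rw [hsumX, map_sub, map_neg, zproj_cderiv hVd]
        simp only [hV, lift, zproj_point]
        rw [D.cderiv_leafDir κ p (X k p) rfl]
        simp only [hX, lift, zproj_point]
        rw [← had, hκ, ← hη_def]
        have : (Complex.I * (Real.exp t : ℂ) * Complex.I) = -(Real.exp t : ℂ) := by
          linear_combination (Real.exp t : ℂ) * Complex.I_sq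
        rw [this, neg_smul, neg_neg, sub_self]
      rw [hc0, hcz]
      refine point_ext rfl ?_ rfl
      simp [lift]
    change -cderiv V p (0, star (X k p)) - ∑ j, A j k • X j p ∈ _
    rw [hzero]
    exact Submodule.zero_mem _

end Symbol

end GradedForm

end CRGeom

/-! ### Automorphisms, homogeneity and connectedness of the model. -/

namespace CRGeom

section Automorphisms

variable {N : ℕ}

/-- `φ` and `ψ` are mutually inverse global biholomorphisms preserving `M`. -/
structure IsAutPair (M : Set (Cspace N)) (φ ψ : Cspace N → Cspace N) : Prop where
  contDiff : ContDiff ℂ ∞ φ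
  contDiff_inv : ContDiff ℂ ∞ ψ
  mapsTo : Set.MapsTo φ M M
  mapsTo_inv : Set.MapsTo ψ M M
  left_inv : ∀ x, ψ (φ x) = x
  right_inv : ∀ x, φ (ψ x) = x

theorem IsAutPair.symm {M : Set (Cspace N)} {φ ψ : Cspace N → Cspace N} (h : IsAutPair M φ ψ) :
    IsAutPair M ψ φ :=
  ⟨h.2, h.1, h.4, h.3, h.6, h.5⟩

theorem IsAutPair.comp {M : Set (Cspace N)} {φ ψ φ' ψ' : Cspace N → Cspace N}
    (h : IsAutPair M φ ψ) (h' : IsAutPair M φ' ψ') : IsAutPair M (φ' ∘ φ) (ψ ∘ ψ') where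
  contDiff := h'.contDiff.comp h.contDiff
  contDiff_inv := h.contDiff_inv.comp h'.contDiff_inv
  mapsTo := h'.mapsTo.comp h.mapsTo
  mapsTo_inv := h.mapsTo_inv.comp h'.mapsTo_inv
  left_inv x := by simp [h.left_inv, h'.left_inv]
  right_inv x := by simp [h.right_inv, h'.right_inv]

theorem isHomogeneous_of_isAutPair {M : Set (Cspace N)} (b : Cspace N)
    (h : ∀ p ∈ M, ∃ φ ψ, IsAutPair M φ ψ ∧ φ p = b) : IsHomogeneous M := by
  intro p hp q hq
  obtain ⟨φ, ψ, h1, hφ⟩ := h p hp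
  obtain ⟨φ', ψ', h2, hφ'⟩ := h q hq
  have h3 := h1.comp h2.symm
  exact ⟨_, _, isCRMap_of_contDiff h3.contDiff h3.mapsTo,
    isCRMap_of_contDiff h3.contDiff_inv h3.mapsTo_inv,
    fun x _ => ⟨h3.left_inv x, h3.right_inv x⟩, by
      rw [Function.comp_apply, hφ, ← hφ', h2.left_inv]⟩

end Automorphisms

namespace GradedForm

variable {m : ℕ} (D : GradedForm m)

theorem isAutPair_translation (ξ t : ℝ) : IsAutPair D.model
    (fun x => x + point ξ (t * Complex.I) 0) (fun x => x - point ξ (t * Complex.I) 0) where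
  contDiff := contDiff_id.add contDiff_const
  contDiff_inv := contDiff_id.sub contDiff_const
  mapsTo := fun x hx => by
    have hz : zproj m (x + point ξ (t * Complex.I) 0) = zproj m x := by simp
    have h0 : (x + point ξ (t * Complex.I) 0 : Cspace (m + 2)) 0 = x 0 + ξ := rfl
    have h1 : (x + point ξ (t * Complex.I) 0 : Cspace (m + 2)) 1 = x 1 + t * Complex.I := rfl
    simpa [model, potential, hz, h0, h1] using hx
  mapsTo_inv := fun x hx => by
    have hz : zproj m (x - point ξ (t * Complex.I) 0) = zproj m x := by simp
    have h0 : (x - point ξ (t * Complex.I) 0 : Cspace (m + 2)) 0 = x 0 - ξ := rfl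
    have h1 : (x - point ξ (t * Complex.I) 0 : Cspace (m + 2)) 1 = x 1 - t * Complex.I := rfl
    simpa [model, potential, hz, h0, h1] using hx
  left_inv x := by simp
  right_inv x := by simp

theorem contDiff_zproj_complex : ContDiff ℂ ∞ (zproj m) := (zproj m).contDiff

/-- `U t` preserves `ell` and intertwines E at heights η and e^t η, so the potential is unchanged.
-/
theorem mapsTo_scaling (t : ℝ) : Set.MapsTo
    (fun x : Cspace (m + 2) => point (Real.exp t * x 0) (x 1) (D.U t (zproj m x)))
    D.model D.model := by
  rintro x ⟨hx, hx'⟩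
  refine ⟨?_, ?_⟩
  · change 0 < ((Real.exp t : ℂ) * x 0).im
    rw [Complex.im_ofReal_mul]
    exact mul_pos (Real.exp_pos t) hx
  · have h := congrArg (fun T : ROp m => T (zproj m x))
      (D.semiconj_U_E t (Real.exp t * (x 0).im))
    rw [← mul_assoc, ← Real.exp_add, neg_add_cancel, Real.exp_zero, one_mul] at h
    change D.U t (D.E (x 0).im (zproj m x)) = D.E _ (D.U t (zproj m x)) at h
    simp only [potential, point_one, point_zero, zproj_point, Complex.im_ofReal_mul]
    rw [← h, D.ell_U]
    exact hx'

theorem contDiff_scaling (t : ℝ) : ContDiff ℂ ∞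
    (fun x : Cspace (m + 2) => point (Real.exp t * x 0) (x 1) (D.U t (zproj m x))) :=
  contDiff_point (contDiff_const.mul (contDiff_apply ℂ ℂ 0)) (contDiff_apply ℂ ℂ 1)
    ((contDiff_of_commute_mulI (D.commute_mulI_U t)).comp contDiff_zproj_complex)

theorem scaling_neg_scaling (t : ℝ) (x : Cspace (m + 2)) :
    point (Real.exp t * (Real.exp (-t) * x 0)) (x 1) (D.U t (D.U (-t) (zproj m x))) = x := by
  have h1 : D.U t (D.U (-t) (zproj m x)) = zproj m x :=
    congrArg (fun T : ROp m => T (zproj m x)) (D.U_mul_U_neg t)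
  have h2 : (Real.exp t : ℂ) * Real.exp (-t) = 1 := by
    rw [← Complex.ofReal_mul, ← Real.exp_add]; simp
  rw [h1, ← mul_assoc, h2, one_mul]
  exact point_ext rfl rfl rfl

theorem isAutPair_scaling (t : ℝ) : IsAutPair D.model
    (fun x => point (Real.exp t * x 0) (x 1) (D.U t (zproj m x)))
    (fun x => point (Real.exp (-t) * x 0) (x 1) (D.U (-t) (zproj m x))) where
  contDiff := D.contDiff_scaling t
  contDiff_inv := D.contDiff_scaling (-t)
  mapsTo := D.mapsTo_scaling t
  mapsTo_inv := D.mapsTo_scaling (-t)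
  left_inv x := by simpa using D.scaling_neg_scaling (-t) x
  right_inv x := D.scaling_neg_scaling t x

/-- The Heisenberg translation of the model along the leaf curve with parameter `c`. -/
noncomputable def leafShift (c : Cspace m) (x : Cspace (m + 2)) : Cspace (m + 2) :=
  point (x 0) (x 1 + 2 * D.ell (zproj m x) (D.leaf c (star (x 0))) +
    D.ell (D.leaf c (x 0)) (D.leaf c (star (x 0)))) (zproj m x + D.leaf c (x 0))

theorem contDiff_leafShift (c : Cspace m) : ContDiff ℂ ∞ (D.leafShift c) := by
  have h0 : ContDiff ℂ ∞ (fun x : Cspace (m + 2) => x 0) := contDiff_apply ℂ ℂ 0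
  have hf : ContDiff ℂ ∞ (fun x : Cspace (m + 2) => D.leaf c (x 0)) := (D.contDiff_leaf c).comp h0
  have hell : ∀ g : Cspace (m + 2) → Cspace m, ContDiff ℂ ∞ g →
      ContDiff ℂ ∞ (fun x => D.ell (g x) (D.leaf c (star (x 0)))) := by
    intro g hg
    have : (fun x : Cspace (m + 2) => D.ell (g x) (D.leaf c (star (x 0)))) =
        fun x => ∑ j, g x j * D.ell (Pi.single j 1) (D.leaf c (star (x 0))) :=
      funext fun x => D.ell_eq_sum _ _
    rw [this]
    exact ContDiff.sum fun j _ =>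
      (contDiff_pi.1 hg j).mul ((D.contDiff_ell_leaf_star (Pi.single j 1) c).comp h0)
  exact contDiff_point h0
    (((contDiff_apply ℂ ℂ 1).add (contDiff_const.mul (hell _ contDiff_zproj_complex))).add
      (hell _ hf)) (contDiff_zproj_complex.add hf)

/-- Expand the potential at z + f(ζ). Since E is self-adjoint and E f(ζ) = f(conj ζ), the extra
terms are 2 Re ell(z, f(conj ζ)) + Re ell(f(ζ), f(conj ζ)), exactly the change of Re w. -/
theorem mapsTo_leafShift (c : Cspace m) : Set.MapsTo (D.leafShift c) D.model D.model := by
  rintro x ⟨hx, hx'⟩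
  refine ⟨hx, ?_⟩
  simp only [potential] at hx'
  simp only [leafShift, potential, point_one, point_zero, zproj_point, map_add, add_apply,
    Complex.add_re, hx', D.E_leaf]
  rw [D.isSelfAdj_E (x 0).im (zproj m x) (D.leaf c (x 0)), D.E_leaf,
    D.ell_re_comm (D.leaf c (star (x 0))) (zproj m x),
    D.ell_re_comm (D.leaf c (star (x 0))) (D.leaf c (x 0)), two_mul, Complex.add_re]
  ring

theorem leafShift_neg (c : Cspace m) (x : Cspace (m + 2)) :
    D.leafShift (-c) (D.leafShift c x) = x := by
  refine point_ext rfl ?_ (by simp [leafShift, D.leaf_neg])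
  simp only [leafShift, point_one, point_zero, zproj_point, D.leaf_neg, map_neg, map_add,
    add_apply, neg_apply]
  ring

theorem isAutPair_leafShift (c : Cspace m) :
    IsAutPair D.model (D.leafShift c) (D.leafShift (-c)) where
  contDiff := D.contDiff_leafShift c
  contDiff_inv := D.contDiff_leafShift (-c)
  mapsTo := D.mapsTo_leafShift c
  mapsTo_inv := D.mapsTo_leafShift (-c)
  left_inv := D.leafShift_neg c
  right_inv x := by simpa using D.leafShift_neg (-c) x

theorem isHomogeneous : IsHomogeneous D.model := by
  refine isHomogeneous_of_isAutPair (point (Complex.I / 2) 0 0) fun p hp => ?_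
  have hη : 0 < (p 0).im := hp.1
  set t := Real.log (1 / (2 * (p 0).im)) with ht
  have hexp : Real.exp t = 1 / (2 * (p 0).im) := Real.exp_log (by positivity)
  have a1 := D.isAutPair_translation (-(p 0).re) 0
  have a2 := D.isAutPair_scaling t
  -- At ζ = i/2 the leaf curve takes the value P(-1/2) c; as this operator is invertible, c can be
  -- chosen to cancel the z-component.
  obtain ⟨T, hT⟩ := (D.isUnit_P (-(1 / 2))).exists_right_inv
  set c : Cspace m := -T (D.U t (zproj m p)) with hc
  have a3 := D.isAutPair_leafShift c
  have a123 := (a1.comp a2).comp a3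
  obtain ⟨φ, hφ⟩ : ∃ φ, φ = D.leafShift c ∘ (fun x => point (Real.exp t * x 0) (x 1)
    (D.U t (zproj m x))) ∘ (fun x => x + point ((-(p 0).re : ℝ) : ℂ) ((0 : ℝ) * Complex.I) 0) :=
    ⟨_, rfl⟩
  change IsAutPair D.model (D.leafShift c ∘ (fun x => point (Real.exp t * x 0) (x 1)
    (D.U t (zproj m x))) ∘ (fun x => x + point ((-(p 0).re : ℝ) : ℂ) ((0 : ℝ) * Complex.I) 0)) _
    at a123
  rw [← hφ] at a123
  have hq : φ p ∈ D.model := a123.mapsTo hp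
  have hζ : (Real.exp t : ℂ) * (p 0 + ((-(p 0).re : ℝ) : ℂ)) = ((1 / 2 : ℝ) : ℂ) * Complex.I := by
    rw [hexp]
    conv_lhs => rw [← Complex.re_add_im (p 0)]
    simp only [Complex.add_re, Complex.ofReal_re, Complex.mul_re, Complex.I_re, mul_zero,
      Complex.ofReal_im, Complex.I_im, mul_one, sub_self, add_zero, Complex.add_im,
      Complex.mul_im, zero_add]
    have : ((p 0).im : ℂ) ≠ 0 := Complex.ofReal_ne_zero.2 hη.ne'
    push_cast
    field_simp
    ring
  have h0 : φ p 0 = Complex.I / 2 := by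
    rw [hφ]
    change (Real.exp t : ℂ) * (p 0 + ((-(p 0).re : ℝ) : ℂ)) = _
    rw [hζ]; push_cast; ring
  have hz : zproj m (φ p) = 0 := by
    rw [hφ]
    change D.U t (zproj m (p + point _ _ 0)) +
      D.leaf c ((Real.exp t : ℂ) * (p 0 + ((-(p 0).re : ℝ) : ℂ))) = 0
    rw [hζ, D.leaf_imaginary, hc, map_neg, map_add, zproj_point, add_zero]
    have := congrArg (fun S : ROp m => S (D.U t (zproj m p))) hT
    change D.P (-(1 / 2)) (T _) = _ at this
    rw [this]
    simp
  have hre : (φ p 1).re = 0 := by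
    rw [hq.2, potential, hz]; simp
  have a4 := D.isAutPair_translation 0 (-(φ p 1).im)
  refine ⟨_, _, a123.comp a4, ?_⟩
  rw [Function.comp_apply]
  refine point_ext ?_ ?_ ?_
  · change φ p 0 + ((0 : ℝ) : ℂ) = Complex.I / 2
    rw [h0]; simp
  · change φ p 1 + ((-(φ p 1).im : ℝ) : ℂ) * Complex.I = 0
    apply Complex.ext <;> simp [hre]
  · rw [map_add, hz]; simp

/-- The model is a graph over the half-plane in ζ times the spaces of z and Im w. -/
theorem isConnected : IsConnected D.model := by
  let g : ℂ × Cspace m × ℝ → Cspace (m + 2) := fun y =>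
    point y.1 (((D.ell (D.E y.1.im y.2.1) y.2.1).re : ℂ) + y.2.2 * Complex.I) y.2.1
  have hg : Continuous g := by
    have h1 : Continuous fun y : ℂ × Cspace m × ℝ => D.E y.1.im y.2.1 :=
      (D.contDiff_E.continuous.comp (Complex.continuous_im.comp continuous_fst)).clm_apply
        (continuous_fst.comp continuous_snd)
    have h2 : Continuous fun y : ℂ × Cspace m × ℝ => D.ell (D.E y.1.im y.2.1) y.2.1 :=
      (D.ell.continuous.comp h1).clm_apply (continuous_fst.comp continuous_snd)
    refine continuous_pi fun i => Fin.cases continuous_fst (fun i => Fin.cases ?_ (fun j => ?_) i) i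
    · exact (Complex.continuous_ofReal.comp (Complex.continuous_re.comp h2)).add
        ((Complex.continuous_ofReal.comp (continuous_snd.comp continuous_snd)).mul
          continuous_const)
    · exact (continuous_apply j).comp (continuous_fst.comp continuous_snd)
  have himage : D.model = g '' ({ζ : ℂ | 0 < ζ.im} ×ˢ Set.univ) := by
    ext x
    constructor
    · rintro ⟨hx, hx'⟩
      refine ⟨(x 0, zproj m x, (x 1).im), ⟨hx, trivial⟩, point_ext rfl ?_ rfl⟩
      change ((D.potential x : ℝ) : ℂ) + (x 1).im * Complex.I = x 1
      rw [← hx', Complex.re_add_im]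
    · rintro ⟨y, hy, rfl⟩
      refine ⟨hy.1, ?_⟩
      simp [g, potential]
  rw [himage]
  have hc : IsConnected ({ζ : ℂ | 0 < ζ.im} ×ˢ (Set.univ : Set (Cspace m × ℝ))) := by
    refine IsConnected.prod ?_ isConnected_univ
    exact (convex_halfSpace_im_gt 0).isConnected ⟨Complex.I, by simp⟩
  exact hc.image g hg.continuousOn

end GradedForm

end CRGeom

/-! ### Building the graded data from a given symbol. -/

namespace CRGeom

section Construction

variable {m : ℕ}

/-- The real part of a real-bilinear form as a bilinear form. -/
noncomputable def reForm (ell : Cspace m →L[ℝ] Cspace m →L[ℝ] ℂ) :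
    LinearMap.BilinForm ℝ (Cspace m) :=
  LinearMap.mk₂ ℝ (fun x y => (ell x y).re) (by simp) (by simp) (by simp) (by simp)

theorem reForm_apply (ell : Cspace m →L[ℝ] Cspace m →L[ℝ] ℂ) (x y : Cspace m) :
    reForm ell x y = (ell x y).re := rfl

theorem exists_gradedForm (ell : Cspace m →L[ℝ] Cspace m →L[ℝ] ℂ) (s : ROp m) (K : ℕ)
    (ell_I_left : ∀ x y, ell (Complex.I • x) y = Complex.I * ell x y)
    (ell_conj : ∀ x y, ell y x = star (ell x y))
    (nondeg : ∀ x, (∀ y, ell x y = 0) → x = 0)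
    (s_mulI : mulI m * s = -s * mulI m)
    (s_adj : ∀ x y, ell (s x) y = ell (s y) x) (K_pos : 0 < K) (s_pow : s ^ K = 0) :
    ∃ D : GradedForm m, D.ell = ell ∧ D.s = s ∧ D.K = K := by
  have ell_I_right : ∀ x y, ell x (Complex.I • y) = -(Complex.I * ell x y) := fun x y => by
    rw [ell_conj, ell_I_left, ell_conj x y]; simp
  have him : ∀ x y, (ell x y).im = (ell x (Complex.I • y)).re := fun x y => by
    rw [ell_I_right]; simp
  have hsymm : ∀ x y, reForm ell x y = reForm ell y x := fun x y => by
    rw [reForm_apply, ell_conj y x]; simp [reForm_apply]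
  have hsep : ∀ x, (∀ y, reForm ell x y = 0) → x = 0 := fun x hx => nondeg x fun y =>
    Complex.ext (hx y) (by rw [him]; exact hx _)
  have hB : (reForm ell).Nondegenerate :=
    ⟨hsep, fun y hy => hsep y fun x => by rw [hsymm]; exact hy x⟩
  obtain ⟨h₀, hh₀⟩ := exists_grading_end (N := (s : Module.End ℝ (Cspace m)))
    ⟨K, by
      have := congrArg (fun T : ROp m => (T : Module.End ℝ (Cspace m))) s_pow
      simpa using this⟩
  have hh₀' : ∀ x, h₀ (s x) - s (h₀ x) = s x := fun x => congrArg (fun T => T x) hh₀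
  -- Adjunction reverses commutators and fixes `s`, so [s, h₀'] = s. Half the difference h₀ - h₀' is
  -- then skew and still satisfies [h, s] = s.
  set h₀' := (reForm ell).leftAdjointOfNondegenerate hB h₀ with hadj
  have hpair : ∀ x y, reForm ell (h₀' x) y = reForm ell x (h₀ y) := fun x y =>
    LinearMap.BilinForm.isAdjointPairLeftAdjointOfNondegenerate (reForm ell) hB h₀ x y
  have hs : ∀ x y, reForm ell (s x) y = reForm ell x (s y) := fun x y => by
    rw [reForm_apply, s_adj]; exact hsymm _ _
  have hh₁' : ∀ x, s (h₀' x) - h₀' (s x) = s x := fun x => by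
    rw [← sub_eq_zero]
    apply hsep
    intro y
    rw [map_sub, map_sub, LinearMap.sub_apply, LinearMap.sub_apply, hs, hpair, hpair, hs, hs,
      ← map_sub, ← map_sub, hh₀', sub_self, map_zero]
  let h₁ : ROp m := LinearMap.toContinuousLinearMap ((1 / 2 : ℝ) • (h₀ - h₀'))
  have hh₁ : ∀ x, h₁ x = (1 / 2 : ℝ) • (h₀ x - h₀' x) := fun x => rfl
  have h₁_s : h₁ * s - s * h₁ = s := by
    ext1 x
    change h₁ (s x) - s (h₁ x) = s x
    rw [hh₁, hh₁, map_smul, map_sub, ← smul_sub]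
    have : h₀ (s x) - h₀' (s x) - (s (h₀ x) - s (h₀' x)) = (2 : ℝ) • s x := by
      rw [two_smul]
      linear_combination hh₀' x + hh₁' x
    rw [this, smul_smul]; norm_num
  have h₁_skew : ∀ x y, reForm ell (h₁ x) y = -reForm ell x (h₁ y) := fun x y => by
    have h2 : ∀ x y, reForm ell (h₀ x) y = reForm ell x (h₀' y) := fun x y => by
      rw [hsymm, ← hpair, hsymm]
    rw [hh₁, hh₁, map_smul, map_smul, LinearMap.smul_apply, map_sub, map_sub,
      LinearMap.sub_apply, hpair, h2, ← smul_neg, neg_sub]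
  -- Averaging h₁ with its conjugate by i yields a complex-linear operator. The grading relation
  -- survives because that conjugation sends `s` to -s, and the relation is linear in `s`.
  let h₂ : ROp m := (1 / 2 : ℝ) • (h₁ - mulI m * h₁ * mulI m)
  have hJ : ∀ T : ROp m, mulI m * (mulI m * T) = -T := fun T => by
    rw [← mul_assoc, mulI_mul_self, neg_one_mul]
  have hJI : ∀ x y, reForm ell (mulI m x) y = -reForm ell x (mulI m y) := fun x y => by
    rw [reForm_apply, reForm_apply, mulI_apply, mulI_apply, ell_I_left, ell_I_right]; simp
  have h₂_comm : Commute (mulI m) h₂ := by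
    refine Commute.smul_right ?_ _
    rw [commute_iff_eq, mul_sub, sub_mul, mul_assoc (mulI m) h₁, hJ, mul_assoc, mul_assoc,
      mulI_mul_self, mul_neg, mul_neg, mul_one]
    abel
  have h₂_skew : ∀ x y, reForm ell (h₂ x) y = -reForm ell x (h₂ y) := fun x y => by
    have e : ∀ x, h₂ x = (1 / 2 : ℝ) • (h₁ x - mulI m (h₁ (mulI m x))) := fun x => rfl
    rw [e, e, map_smul, map_smul, LinearMap.smul_apply, map_sub, map_sub, LinearMap.sub_apply,
      hJI, h₁_skew, h₁_skew, hJI, ← smul_neg]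
    congr 1
    ring
  refine ⟨⟨ell, s, h₂, K, ell_I_left, ell_conj, nondeg, s_mulI, s_adj, K_pos, s_pow, h₂_comm,
    fun x y => ?_, ?_⟩, rfl, rfl, rfl⟩
  · apply Complex.ext
    · exact h₂_skew x y
    · have hI : h₂ (Complex.I • y) = Complex.I • h₂ y :=
        (congrArg (fun T : ROp m => T y) h₂_comm.eq).symm
      rw [Complex.neg_im, him, him, ← hI]
      exact h₂_skew x _
  · have e1 : mulI m * h₁ * mulI m * s = -(mulI m * (h₁ * s) * mulI m) := by
      rw [mul_assoc, s_mulI]; simp only [neg_mul, mul_neg, mul_assoc]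
    have e2 : s * (mulI m * h₁ * mulI m) = -(mulI m * (s * h₁) * mulI m) := by
      have : s * mulI m = -(mulI m * s) := by rw [s_mulI, neg_mul, neg_neg]
      rw [← mul_assoc, ← mul_assoc, this]; simp only [neg_mul, mul_assoc]
    have e3 : mulI m * s * mulI m = s := by
      rw [s_mulI, mul_assoc, mulI_mul_self]; simp
    change (1 / 2 : ℝ) • (h₁ - mulI m * h₁ * mulI m) * s -
      s * ((1 / 2 : ℝ) • (h₁ - mulI m * h₁ * mulI m)) = s
    rw [smul_mul_assoc, mul_smul_comm, ← smul_sub, sub_mul, mul_sub, e1, e2]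
    have e4 : h₁ * s - -(mulI m * (h₁ * s) * mulI m) -
        (s * h₁ - -(mulI m * (s * h₁) * mulI m)) =
        (h₁ * s - s * h₁) + mulI m * (h₁ * s - s * h₁) * mulI m := by
      rw [mul_sub, sub_mul]; abel
    rw [e4, h₁_s, e3, ← two_smul ℝ, smul_smul]
    norm_num

theorem self_adj_of_re {T : ROp m} (hT : mulI m * T = -T * mulI m)
    {ell : Cspace m →L[ℝ] Cspace m →L[ℝ] ℂ} (ell_conj : ∀ x y, ell y x = star (ell x y))
    (ell_I_left : ∀ x y, ell (Complex.I • x) y = Complex.I * ell x y)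
    (h : ∀ x y, reForm ell (T x) y = reForm ell x (T y)) (x y : Cspace m) :
    ell (T x) y = ell (T y) x := by
  have hI : ∀ x y, (ell x y).im = (ell x (Complex.I • y)).re := fun x y => by
    rw [ell_conj, ell_conj (Complex.I • y), ell_I_left]; simp
  have hTI : T (Complex.I • y) = -(Complex.I • T y) := by
    have := congrArg (fun S : ROp m => S y) hT
    change Complex.I • T y = -T (Complex.I • y) at this
    rw [this, neg_neg]
  apply Complex.ext
  · rw [ell_conj x]
    exact (h x y).trans (by simp [reForm_apply])
  · have h2 := h x (Complex.I • y)
    rw [reForm_apply, reForm_apply, hTI, map_neg, Complex.neg_re, ← hI, ← hI] at h2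
    rw [h2, ell_conj x]
    simp

open Polynomial in
/-- Every nilpotent self-adjoint antilinear operator `a` is `s / cos s` for a nilpotent antilinear
operator `s`. -/
theorem exists_sec_root {a : ROp m} (hI : mulI m * a = -a * mulI m) {K : ℕ} (hK : a ^ K = 0)
    (ell : Cspace m →L[ℝ] Cspace m →L[ℝ] ℂ) (ell_conj : ∀ x y, ell y x = star (ell x y))
    (ell_I_left : ∀ x y, ell (Complex.I • x) y = Complex.I * ell x y)
    (ha : ∀ x y, ell (a x) y = ell (a y) x) :
    ∃ s : ROp m, mulI m * s = -s * mulI m ∧ s ^ K = 0 ∧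
      (∀ x y, ell (s x) y = ell (s y) x) ∧
      s = a * (trigSum K s (1 / 2) * trigSum K s (-(1 / 2))) := by
  -- C represents cos modulo X^K. It is even, so s = a C(s) has a solution q(a) with q odd, hence
  -- antilinear; X divides q, hence q(a)^K = 0.
  let C : ℝ[X] := trigSum K X (1 / 2) * trigSum K X (-(1 / 2))
  have hC : C.comp (-X) = C := by
    have h1 : ∀ η : ℝ, (trigSum K X η : ℝ[X]).comp (-X) = trigSum K X (-η) := fun η => by
      rw [trigSum_neg, ← coe_compRingHom_apply]
      simp [trigSum, comp, smul_eq_C_mul]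
    rw [mul_comp, h1, h1, neg_neg, mul_comm]
  obtain ⟨q, ⟨r, hr⟩, hodd, hq⟩ := exists_odd_polynomial hC K
  have hconj : ∀ p : ℝ[X], mulI m * aeval a p = aeval a (p.comp (-X)) * mulI m := by
    intro p
    induction p using Polynomial.induction_on' with
    | add p q hp hq => rw [map_add, mul_add, hp, hq, add_comp, map_add, add_mul]
    | monomial n c =>
      have : SemiconjBy (mulI m) (a ^ n) ((-a) ^ n) := SemiconjBy.pow_right hI n
      rw [aeval_monomial, monomial_comp, map_mul, map_pow, map_neg, aeval_X, aeval_C,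
        ← mul_assoc, ← (Algebra.commutes c (mulI m)), mul_assoc, this.eq, mul_assoc]
  have hre : ∀ p : ℝ[X], ∀ x y, reForm ell (aeval a p x) y = reForm ell x (aeval a p y) := by
    have hpow : ∀ n x y, reForm ell ((a ^ n) x) y = reForm ell x ((a ^ n) y) := by
      intro n
      induction n with
      | zero => intro x y; rfl
      | succ n ih =>
        intro x y
        have e1 : (a ^ (n + 1)) x = (a ^ n) (a x) := by rw [pow_succ]; rfl
        have e2 : (a ^ (n + 1)) y = a ((a ^ n) y) := by rw [pow_succ']; rfl
        rw [e1, e2, ih, reForm_apply, reForm_apply, ha, ell_conj]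
        simp
    intro p x y
    induction p using Polynomial.induction_on' with
    | add p q hp hq => simp only [map_add, add_apply, LinearMap.add_apply, hp, hq]
    | monomial n c =>
      have e : aeval a (monomial n c) = c • a ^ n := by
        rw [aeval_monomial, Algebra.smul_def]
      simp only [e, smul_apply, map_smul, LinearMap.smul_apply, hpow]
  refine ⟨aeval a q, ?_, ?_, ?_, ?_⟩
  · rw [hconj, hodd, map_neg]
  · rw [hr, map_mul, aeval_X, (show Commute a (aeval a r) by
      have := (Commute.all X r).map (aeval a); simpa using this).mul_pow, hK, zero_mul]
  · exact self_adj_of_re (by rw [hconj, hodd, map_neg]) ell_conj ell_I_left (hre q)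
  · have h1 : aeval a (q - X * C.comp q) = 0 := by
      obtain ⟨u, hu⟩ := hq
      rw [hu, map_mul, map_pow, aeval_X, hK, zero_mul]
    rw [map_sub, map_mul, aeval_X, aeval_comp, sub_eq_zero] at h1
    conv_lhs => rw [h1]
    congr 1
    simp only [C, map_mul, map_trigSum, aeval_X]

/-- The real-linear operator `x ↦ A conj(x)`. -/
noncomputable def antilinearROp (A : Matrix (Fin m) (Fin m) ℂ) : ROp m :=
  LinearMap.toContinuousLinearMap
    { toFun := antilinearOp A
      map_add' := fun x y => by simp [antilinearOp, Matrix.mulVec_add]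
      map_smul' := fun r x => by
        rw [antilinearOp, star_real_smul_Cspace, Matrix.mulVec_smul]; rfl }

theorem mulI_mul_antilinearROp (A : Matrix (Fin m) (Fin m) ℂ) :
    mulI m * antilinearROp A = -antilinearROp A * mulI m := by
  ext1 x
  change Complex.I • (A *ᵥ star x) = -(A *ᵥ star (Complex.I • x))
  rw [star_smul, Matrix.mulVec_smul]
  simp

/-- The Hermitian form with matrix `H` as a real-bilinear map. -/
noncomputable def sesqROp (H : Matrix (Fin m) (Fin m) ℂ) :
    Cspace m →L[ℝ] Cspace m →L[ℝ] ℂ :=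
  (LinearMap.mk₂ ℝ (sesqForm H) (by simp [sesqForm, add_dotProduct])
    (by simp [sesqForm])
    (by simp [sesqForm, Matrix.mulVec_add, dotProduct_add])
    (fun r x y => by
      rw [sesqForm, star_real_smul_Cspace, Matrix.mulVec_smul, dotProduct_smul]; rfl)
    ).toContinuousBilinearMap

theorem sesqROp_apply (H : Matrix (Fin m) (Fin m) ℂ) (x y : Cspace m) :
    sesqROp H x y = sesqForm H x y := rfl

theorem sesqROp_I_left (H : Matrix (Fin m) (Fin m) ℂ) (x y : Cspace m) :
    sesqROp H (Complex.I • x) y = Complex.I * sesqROp H x y := by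
  simp [sesqROp_apply, sesqForm]

theorem sesqROp_conj {H : Matrix (Fin m) (Fin m) ℂ} (hH : H.IsHermitian) (x y : Cspace m) :
    sesqROp H y x = star (sesqROp H x y) := by
  rw [sesqROp_apply, sesqROp_apply, sesqForm, sesqForm, ← Matrix.star_dotProduct_star,
    Matrix.star_mulVec, star_star, hH.eq, Matrix.dotProduct_mulVec]

theorem sesqROp_nondeg {H : Matrix (Fin m) (Fin m) ℂ} (hH : IsUnit H.det) (x : Cspace m)
    (hx : ∀ y, sesqROp H x y = 0) : x = 0 := by
  refine dotProduct_eq_zero x fun z => ?_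
  have h := hx (star (H⁻¹ *ᵥ z))
  rw [sesqROp_apply, sesqForm, star_star, Matrix.mulVec_mulVec, Matrix.mul_nonsing_inv H hH,
    Matrix.one_mulVec] at h
  exact h

theorem exists_gradedForm_of_encodesCRSymbol {H A : Matrix (Fin m) (Fin m) ℂ}
    (hHA : EncodesCRSymbol H A) (hnil : ∃ k : ℕ, ∀ x : Fin m → ℂ, (antilinearOp A)^[k] x = 0) :
    ∃ D : GradedForm m, (∀ x y, D.ell x (D.sec (1 / 2) y) = sesqForm H x y) ∧
      ∀ x, D.s (D.sec (1 / 2) x) = antilinearOp A x := by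
  obtain ⟨k, hk⟩ := hnil
  -- The exponent k + 1 keeps the truncation order positive, since the empty sum is 0 rather than 1.
  have hpow : antilinearROp A ^ (k + 1) = 0 := by
    have : antilinearROp A ^ k = 0 := by
      ext1 x
      have hiter : ∀ n, (antilinearROp A ^ n) x = (antilinearOp A)^[n] x := fun n => by
        induction n with
        | zero => rfl
        | succ n ih => rw [Function.iterate_succ_apply', ← ih, pow_succ']; rfl
      rw [hiter, hk]; rfl
    rw [pow_succ, this, zero_mul]
  have hconj := sesqROp_conj hHA.hermitian
  obtain ⟨s, hs1, hs2, hs3, hs4⟩ := exists_sec_root (mulI_mul_antilinearROp A) hpow (sesqROp H)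
    hconj (sesqROp_I_left H) hHA.selfAdjoint
  -- `D₀` keeps the given form and only supplies properties of cos(s) and sec(s), which do not
  -- depend on the form.
  obtain ⟨D₀, hD1, hD2, hD3⟩ := exists_gradedForm (sesqROp H) s (k + 1) (sesqROp_I_left H) hconj
    (sesqROp_nondeg hHA.nondegenerate) hs1 hs3 k.succ_pos hs2
  have hP : D₀.P = trigSum (k + 1) s := by
    funext η; rw [GradedForm.P, hD2, hD3]
  set c : ROp m := D₀.P (1 / 2) * D₀.P (-(1 / 2)) with hc
  have hsc : s * D₀.sec (1 / 2) = antilinearROp A := by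
    conv_lhs => rw [hs4, ← hP, mul_assoc, D₀.mul_sec, mul_one]
  have hcI : Commute (mulI m) c := by
    rw [commute_iff_eq, hc, ← mul_assoc, D₀.mulI_mul_P, mul_assoc, D₀.mulI_mul_P, neg_neg,
      ← mul_assoc, (D₀.commute_P_P (-(1 / 2)) (1 / 2)).eq]
  have hcs : Commute s c := by
    rw [← hD2]; exact (D₀.commute_s_P _).mul_right (D₀.commute_s_P _)
  have hcadj : ∀ x y, sesqROp H (c x) y = sesqROp H x (c y) := by
    rw [← hD1]
    exact ((D₀.isSelfAdj_P _).mul (D₀.isSelfAdj_P _)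
      (D₀.commute_P_P _ _)).ell_apply_of_commute hcI
  have hsc' : ∀ x, s (c x) = c (s x) := fun x => congrArg (fun T : ROp m => T x) hcs.eq
  have hsecc : ∀ x, D₀.sec (1 / 2) (c x) = x := fun x =>
    congrArg (fun T : ROp m => T x) (D₀.sec_mul (1 / 2))
  have hcsec : ∀ x, c (D₀.sec (1 / 2) x) = x := fun x =>
    congrArg (fun T : ROp m => T x) (D₀.mul_sec (1 / 2))
  -- With c = cos(s), the form ℓ(c ·, ·) paired with sec(s) gives back ℓ. It is Hermitian and `s`
  -- stays self-adjoint for it, because c is complex-linear, self-adjoint and commutes with `s`.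
  obtain ⟨D, hE1, hE2, hE3⟩ := exists_gradedForm ((sesqROp H).comp c) s (k + 1)
    (fun x y => by
      change sesqROp H (c (Complex.I • x)) y = Complex.I * sesqROp H (c x) y
      rw [map_complex_smul_of_commute hcI, sesqROp_I_left])
    (fun x y => by
      change sesqROp H (c y) x = star (sesqROp H (c x) y)
      rw [hcadj y x, hconj])
    (fun x hx => by
      have : c x = 0 := sesqROp_nondeg hHA.nondegenerate _ hx
      rw [← hsecc x, this, map_zero])
    hs1
    (fun x y => by
      change sesqROp H (c (s x)) y = sesqROp H (c (s y)) x
      rw [hcadj, hs3, ← hsc', hs3 (c y) x])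
    k.succ_pos hs2
  have hsec : D.sec (1 / 2) = D₀.sec (1 / 2) := by
    simp only [GradedForm.sec, GradedForm.P, hD2, hD3, hE2, hE3]
  refine ⟨D, fun x y => ?_, fun x => ?_⟩
  · rw [hE1, hsec]
    change sesqROp H (c x) _ = _
    rw [hcadj, hcsec, sesqROp_apply]
  · rw [hE2, hsec]
    exact congrArg (fun T : ROp m => T x) hsc

end Construction

end CRGeom

theorem theorem6p3 (m : ℕ) (H A : Matrix (Fin m) (Fin m) ℂ)
    (hHA : CRGeom.EncodesCRSymbol H A)
    (hnil : ∃ k : ℕ, ∀ x : Fin m → ℂ, (CRGeom.antilinearOp A)^[k] x = 0) :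
    ∃ M : Set (CRGeom.Cspace (m + 2)),
      CRGeom.IsRealHypersurface M ∧ IsConnected M ∧ CRGeom.IsHomogeneous M ∧
      CRGeom.IsTwoNondegenerate M 1 ∧ ∀ p ∈ M, CRGeom.HasCRSymbol M p H A := by
  obtain ⟨D, hD1, hD2⟩ := CRGeom.exists_gradedForm_of_encodesCRSymbol hHA hnil
  have hstar : ∀ k : Fin m, star (Pi.single k 1 : Fin m → ℂ) = Pi.single k 1 := fun k => by
    ext i; simp [Pi.single_apply, apply_ite]
  have hsym : ∀ p ∈ D.model, CRGeom.HasCRSymbol D.model p H A := fun p hp =>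
    D.hasCRSymbol
      (fun j k => by
        rw [hD1, CRGeom.sesqForm, hstar]
        simp)
      (fun k => by
        rw [hD2, CRGeom.antilinearOp, hstar]
        ext j
        simp) hp
  exact ⟨D.model, D.isDefinedBy.isRealHypersurface, D.isConnected, D.isHomogeneous,
    CRGeom.isTwoNondegenerate_of_hasCRSymbol hHA.ne_zero hsym, hsym⟩
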